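/- Let $I\subset\mathbb R$ be an interval and $x_0\in I$. *Setting.* A first-order ODE is an arbitrary relation $E(x,y,y')$; a solution on $I$ is a locally absolutely continuous $y:I\to\mathbb R$ with $E(x,y(x),y'(x))$ for a.e. $x\in I$. Two families of functions on $I$ are *equivalent* if every member of each is a member of the other. An *integral by quadratures* is a family $$f(x,c_1,\dots,c_n)=\Theta\bigl(x,F(s_1(x)+c_1,\;s_2(x,c_1)+c_2,\;\dots,\;s_n(x,c_1,\dots,c_{n-1})+c_n)\bigr),\qquad c\in\mathbb R^n,\ n\ge 1,$$ where: $s_j(x,c_1,\dots,c_{j-1})=\int_{x_0}^x\varphi_j(t,s_1(t)+c_1,\dots,s_{j-1}(t,c_1,\dots,c_{j-2})+c_{j-1})\,dt$, the $\varphi_j:I\times\mathbb R^{j-1}\to\mathbb R$ being locally integrable in the first variable, $C^1$ in the others, and such that these integrands are locally integrable on $I$; for some $c\in\mathbb R^{n-1}$ the functions $\varphi_1,\varphi_2(\cdot,c_1),\dots,\varphi_n(\cdot,c_1,\dots,c_{n-1})$ are linearly independent on $I$ modulo null sets; $F:\mathbb R^n\to\mathbb R$ is $C^4$ and $\partial_nF$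 has no zeros; for each $x\in I$, $\Theta(x,\cdot):\mathbb R\to\mathbb R$ is $C^1$ and its derivative has no zeros. **Corollary 1.7.** Suppose that for every real initial value at $x_0$ the equation $E$ has a unique solution on all of $I$, and that it can be integrated by quadratures, i.e. its general solution $(g(\cdot,d))_{d\in\mathbb R}$, $g(x_0,d)=d$, is equivalent to an integral by quadratures $f$ as above. Then $E$ arises from a linear equation by a diffeomorphic transformation of the unknown: there are locally integrable $p,q:I\to\mathbb R$ and $\hat\Theta:I\times\mathbb R\to\mathbb R$ such that for each $x\in I$ the map $\hat\Theta(x,\cdot)$ is a $C^1$ diffeomorphism of $\mathbb R$ onto an open interval $J_x$, with inverse $\Phi(x,\cdot):J_x\to\mathbb R$ ($\partial_2\Phi\ne0$), and the following hold. 1. $y$ is a solution of $E$ on $I$ if and only if $y(x)=\hat\Theta(x,u(x))$ $(x\in I)$ for a solution $u$ on $I$ of $u'+pu=q$. 2. Equivalently, $y$ is a solution of $E$ on $I$ if and only if $y(x)\in J_x$ for all $x\in I$, and $x\mapsto\Phi(x,y(x))$ is locally absolutely continuous with $\frac{d}{dx}\Phi(x,y(x))=q(x)-p(x)\Phi(x,y(x))$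 for a.e. $x\in I$. 3. If $\partial_2\Theta$ is continuous on $I\times\mathbb R$, then along each solution $y$ of $E$ on $I$, for a.e. $x\in I$, $\Phi$ is differentiable at $(x,y(x))$, $y$ is differentiable at $x$, and $$\partial_1\Phi(x,y)+\partial_2\Phi(x,y)\,y'=q(x)-p(x)\,\Phi(x,y).\qquad(*)$$ 4. If, for each $j$, $\partial_c\varphi_j(t,c)$ is bounded, for $c$ in any given compact set and a.e. $t\in I$, by a locally integrable function of $t$, then (with $p,q,\hat\Theta,\Phi$ as above) $\hat\Theta(x,u)=\Theta(x,F(0,\dots,0,u))$ for all $x\in I$, $u\in\mathbb R$. If in addition $\Theta$ is $C^1$ on $I\times\mathbb R$, then $\Phi$ is $C^1$ on $\Omega=\{(x,y):x\in I,\ y\in J_x\}$, and $y$ is a solution of $E$ on $I$ if and only if its graph lies in $\Omega$ and $y$ is a solution on $I$ of the equation $(*)$. -/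

import Mathlib

open MeasureTheory Set

noncomputable section

/-- A first-order ordinary differential equation, given as an arbitrary relation
`E x y y'` between the variable, the unknown and its derivative (no structure is assumed;
an explicit equation `y' = g x y` is the relation `fun x y v => v = g x y`). -/
abbrev FirstOrderODE := ℝ → ℝ → ℝ → Prop

/-- `y` is locally absolutely continuous on the interval `I`. -/
def LocallyAC (I : Set ℝ) (y : ℝ → ℝ) : Prop :=
  ∀ a ∈ I, ∀ b ∈ I, AbsolutelyContinuousOnInterval y a b

/-- `y` is a solution of `E` on the whole interval `I`, in the sense of Carathéodory.
This depends only on the values of `y` on `I`. -/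
def IsSolutionOn (I : Set ℝ) (E : FirstOrderODE) (y : ℝ → ℝ) : Prop :=
  LocallyAC I y ∧ ∀ᵐ x ∂volume.restrict I, E x (y x) (deriv y x)

/-- The linear first-order equation `u' + p u = q`. -/
def linearODE (p q : ℝ → ℝ) : FirstOrderODE :=
  fun x u v => v + p x * u = q x

/-- For each real initial value at `x₀` there is a unique solution defined on all of `I`. -/
def UniquelySolvable (I : Set ℝ) (x₀ : ℝ) (E : FirstOrderODE) : Prop :=
  ∀ η : ℝ, ∃ y : ℝ → ℝ, IsSolutionOn I E y ∧ y x₀ = η ∧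
    ∀ z : ℝ → ℝ, IsSolutionOn I E z → z x₀ = η → EqOn z y I

/-- The general solution on `I × ℝ`: the family of solutions on `I`, parametrized by their
value at `x₀`. -/
def IsGeneralSolution (I : Set ℝ) (x₀ : ℝ) (E : FirstOrderODE) (g : ℝ → ℝ → ℝ) : Prop :=
  ∀ d : ℝ, IsSolutionOn I E (g d) ∧ g d x₀ = d

/-- Equivalence of two families of functions on `I` (the parameter is the first argument). -/
def EquivalentFamilies {α β : Type*} (I : Set ℝ) (f : α → ℝ → ℝ) (g : β → ℝ → ℝ) : Prop :=
  (∀ c, ∃ d, EqOn (f c) (g d) I) ∧ ∀ d, ∃ c, EqOn (f c) (g d) I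

/-- The first `j` of `n` parameters. -/
def initialParams {n : ℕ} (j : Fin n) (c : Fin n → ℝ) : Fin j → ℝ :=
  fun i => c (Fin.castLE j.isLt.le i)

/-- The quadratures `s_j` with integrands `φ_j`; with indices starting at `0`, the integrand
`φ_j` depends on `x` and `j` further real variables, and
`s_j(x, c) = ∫_{x₀}^x φ_j(t, s_0(t) + c_0, …, s_{j-1}(t, c_0, …, c_{j-2}) + c_{j-1}) dt`.
The value `s_j(x, c)` involves only `c_0, …, c_{j-1}`. -/
def quadrature {n : ℕ} (x₀ : ℝ) (φ : (j : Fin n) → ℝ → (Fin j → ℝ) → ℝ)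
    (j : Fin n) (x : ℝ) (c : Fin n → ℝ) : ℝ :=
  ∫ t in x₀..x, φ j t (fun i : Fin j =>
    quadrature x₀ φ (Fin.castLE j.isLt.le i) t c + c (Fin.castLE j.isLt.le i))
termination_by j.val
decreasing_by exact i.isLt

/-- The vector `(s_0(x) + c_0, …, s_{n-1}(x, c_0, …, c_{n-2}) + c_{n-1})`. -/
def shiftedQuadratures {n : ℕ} (x₀ : ℝ) (φ : (j : Fin n) → ℝ → (Fin j → ℝ) → ℝ)
    (x : ℝ) (c : Fin n → ℝ) : Fin n → ℝ :=
  fun j => quadrature x₀ φ j x c + c j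

/-- The recursive formula for quadratures, in terms of `shiftedQuadratures`. -/
theorem quadrature_eq {n : ℕ} (x₀ : ℝ) (φ : (j : Fin n) → ℝ → (Fin j → ℝ) → ℝ)
    (j : Fin n) (x : ℝ) (c : Fin n → ℝ) :
    quadrature x₀ φ j x c =
      ∫ t in x₀..x, φ j t (initialParams j (shiftedQuadratures x₀ φ t c)) := by
  rw [quadrature]
  rfl

/-- The functions `φ_j` are the integrands of a system of quadratures on `I`: locally
integrable in the first variable, continuously differentiable in the others, and such that the
integrals defining the quadratures exist. -/
structure IsQuadratureSystem {n : ℕ} (I : Set ℝ) (x₀ : ℝ)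
    (φ : (j : Fin n) → ℝ → (Fin j → ℝ) → ℝ) : Prop where
  locallyIntegrable : ∀ (j : Fin n) (c : Fin j → ℝ), LocallyIntegrableOn (fun t => φ j t c) I
  contDiff : ∀ (j : Fin n), ∀ t ∈ I, ContDiff ℝ 1 (φ j t)
  integrable : ∀ (j : Fin n) (c : Fin n → ℝ),
    LocallyIntegrableOn (fun t => φ j t (initialParams j (shiftedQuadratures x₀ φ t c))) I

/-- The system is independent: for some values of the parameters the integrands are linearly
independent as locally integrable functions on `I` (that is, modulo null sets). -/
def IsIndependentSystem {n : ℕ} (I : Set ℝ) (φ : (j : Fin n) → ℝ → (Fin j → ℝ) → ℝ) : Prop :=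
  ∃ c : Fin n → ℝ, ∀ a : Fin n → ℝ,
    (∀ᵐ t ∂volume.restrict I, ∑ j, a j * φ j t (initialParams j c) = 0) → a = 0

/-- The derivatives of the integrands with respect to the parameters are locally dominated: on
each compact set of parameters they are bounded by a locally integrable function of `t`. -/
def IsLocallyDominated {n : ℕ} (I : Set ℝ) (φ : (j : Fin n) → ℝ → (Fin j → ℝ) → ℝ) : Prop :=
  ∀ (j : Fin n) (K : Set (Fin j → ℝ)), IsCompact K →
    ∃ m : ℝ → ℝ, LocallyIntegrableOn m I ∧
      ∀ᵐ t ∂volume.restrict I, ∀ c ∈ K, ‖fderiv ℝ (φ j t) c‖ ≤ m t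

/-- `F` is four times continuously differentiable and the partial derivative with respect to
its last variable has no zeros. -/
def IsAdmissible {n : ℕ} (F : (Fin (n + 1) → ℝ) → ℝ) : Prop :=
  ContDiff ℝ 4 F ∧ ∀ c, fderiv ℝ F c (Pi.single (Fin.last n) 1) ≠ 0

/-- `Θ` is continuously differentiable in the second variable, and `∂₂Θ` has no zeros. -/
def IsOuterFunction (I : Set ℝ) (Θ : ℝ → ℝ → ℝ) : Prop :=
  ∀ x ∈ I, ContDiff ℝ 1 (Θ x) ∧ ∀ z, deriv (Θ x) z ≠ 0

/-- The family `f(x, c) = Θ(x, F(s_0(x) + c_0, …, s_n(x, c_0, …, c_{n-1}) + c_n))`. -/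
def quadratureFamily {n : ℕ} (x₀ : ℝ) (Θ : ℝ → ℝ → ℝ) (F : (Fin (n + 1) → ℝ) → ℝ)
    (φ : (j : Fin (n + 1)) → ℝ → (Fin j → ℝ) → ℝ) (c : Fin (n + 1) → ℝ) (x : ℝ) : ℝ :=
  Θ x (F (shiftedQuadratures x₀ φ x c))

/-- The data `Θ, F, φ` define an integral by quadratures, `quadratureFamily x₀ Θ F φ`. -/
structure IsIntegralByQuadratures {n : ℕ} (I : Set ℝ) (x₀ : ℝ) (Θ : ℝ → ℝ → ℝ)
    (F : (Fin (n + 1) → ℝ) → ℝ) (φ : (j : Fin (n + 1)) → ℝ → (Fin j → ℝ) → ℝ) : Prop where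
  outer : IsOuterFunction I Θ
  admissible : IsAdmissible F
  system : IsQuadratureSystem I x₀ φ
  independent : IsIndependentSystem I φ

/-- The region swept out by the values of `Θ`: the pairs `(x, y)` with `x ∈ I`, `y ∈ Θ(x, ℝ)`. -/
def imageRegion (I : Set ℝ) (Θ : ℝ → ℝ → ℝ) : Set (ℝ × ℝ) :=
  {z | z.1 ∈ I ∧ z.2 ∈ range (Θ z.1)}

/-- For each `x ∈ I`, `Θ(x, ·)` is a `C¹` diffeomorphism of `ℝ` onto the (automatically open)
interval `Θ(x, ℝ)`, with inverse `Φ(x, ·)`. -/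
structure IsDiffeomorphicTransformation (I : Set ℝ) (Θ Φ : ℝ → ℝ → ℝ) : Prop where
  contDiff : ∀ x ∈ I, ContDiff ℝ 1 (Θ x)
  deriv_ne_zero : ∀ x ∈ I, ∀ u, deriv (Θ x) u ≠ 0
  leftInverse : ∀ x ∈ I, ∀ u, Φ x (Θ x u) = u
  contDiffOn_inverse : ∀ x ∈ I, ContDiffOn ℝ 1 (Φ x) (range (Θ x))
  deriv_inverse_ne_zero : ∀ x ∈ I, ∀ y ∈ range (Θ x), deriv (Φ x) y ≠ 0

/-- The relation `∂₁Φ(x, y) + ∂₂Φ(x, y) y' = q(x) - p(x) Φ(x, y)`. -/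
def transformedLinearODE (p q : ℝ → ℝ) (Φ : ℝ → ℝ → ℝ) : FirstOrderODE :=
  fun x y v => deriv (fun t => Φ t y) x + deriv (Φ x) y * v = q x - p x * Φ x y

end

/-! Write S(x, c) for `shiftedQuadratures`. Since S(x₀, c) = c and a solution is determined by its
value at x₀, F(S(x, c)) depends on c only through F(c): S(x, ·) maps level sets of F into level
sets, and F is onto. Differentiation in x shows that for a.e. x the triangular field ∑ φ_j(x, ·) ∂_j
is F-related to a vector field k_x on the line (`ae_isProjectable`). Such fields form a vector
space. By independence of the integrands at some c₀, this space contains fields W_i with W_i = ∂_i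
at c₀ (`exists_projectable_frame`), and by triangularity W_i = ∂_i on the whole line c₀ + t e_n,
where e_n is the last basis vector.

The crux is that in the coordinate t of this line all W_i project to affine fields. The projection
of W_i is L_i(t) ∂_t with L_i = ∂_i F / ∂_n F. The derivative of component j of a triangular field
in direction l vanishes unless l < j, so for i < l the bracket of W_i and W_l on the line is a
combination of the ∂_j with j > i. The L_i therefore satisfy triangular bracket relations, and
descending induction makes them affine (`affine_of_bracket_relations`, `exists_affine_ratio`). This
is Lie's description of vector fields on the line: triangularity excludes the quadratic fields of
sl₂.

Affine fields have affine flows. Moving a point to the line through c₀ by the flows of the W_i shows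
that F on any parallel line is F on this line up to an affine change of variable
(`exists_affine_reparametrization`). Hence ψ(t) = F(0, …, 0, t) is a diffeomorphism of ℝ, and k_x
becomes (q - p u) ∂_u in the coordinate u = ψ⁻¹ (`exists_linear_coefficients`). So ψ⁻¹(F(S(x, c)))
solves u' + p u = q, uniqueness for this equation shows that every solution arises so, and the
transformation is Θ(x, ψ(u)).

Two analytic points remain. For fixed c the x-derivative of S exists only off a null set depending
on c. Fubini's theorem and the volume preservation of S(x, ·) give, for a.e. x, a dense set of good
points (`ae_dense_tendsto_quotient`), and continuity does the rest. For the form with partial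
derivatives, Φ must be differentiable along solutions, although Θ need not be differentiable in x.
The curve y(s) = Θ(s, u(s)), transversal to the fibres, supplies the missing derivative
(`hasFDerivAt_of_transversal`). -/

noncomputable section

/-! ### Vector fields on the line with triangular brackets -/

/-- Functions on the line which satisfy triangular bracket relations
`L i' * L l - L l' * L i = ∑ j > i, γ i l j * L j` for `i < l`, the last of them being `1`,
are affine. -/
theorem affine_of_bracket_relations {n : ℕ} (L L' : Fin (n + 1) → ℝ → ℝ)
    (γ : Fin (n + 1) → Fin (n + 1) → Fin (n + 1) → ℝ)
    (hL : ∀ i t, HasDerivAt (L i) (L' i t) t) (hlast : ∀ t, L (Fin.last n) t = 1)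
    (hγ : ∀ i l j, i < l → j ≤ i → γ i l j = 0)
    (h : ∀ i l, i < l → ∀ t, L' i t * L l t - L' l t * L i t = ∑ j, γ i l j * L j t)
    (i : Fin (n + 1)) : ∃ α β : ℝ, ∀ t, L i t = α + β * t := by
  induction i using WellFoundedGT.induction with
  | ind i ih =>
  rcases eq_or_ne i (Fin.last n) with rfl | hi
  · exact ⟨1, 0, fun t => by simp [hlast]⟩
  have hil : i < Fin.last n := lt_of_le_of_ne (Fin.le_last i) hi
  have ih' : ∀ j, ∃ α β : ℝ, i < j → ∀ t, L j t = α + β * t := fun j => by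
    by_cases hj : i < j
    · obtain ⟨α, β, hαβ⟩ := ih j hj
      exact ⟨α, β, fun _ => hαβ⟩
    · exact ⟨0, 0, fun h' => absurd h' hj⟩
  choose a b hab using ih'
  have hsum : ∀ l, i < l → ∀ t, ∑ j, γ i l j * L j t =
      (∑ j, γ i l j * a j) + (∑ j, γ i l j * b j) * t := by
    intro l hl t
    rw [Finset.sum_mul, ← Finset.sum_add_distrib]
    refine Finset.sum_congr rfl fun j _ => ?_
    rcases le_or_gt j i with hj | hj
    · simp [hγ i l j hl hj]
    · rw [hab j hj t]; ring
  have hderiv : ∀ j, i < j → ∀ t, L' j t = b j := by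
    intro j hj t
    have h1 : HasDerivAt (fun t => a j + b j * t) (b j) t := by
      simpa using ((hasDerivAt_id t).const_mul (b j)).const_add (a j)
    exact (hL j t).unique ((funext (hab j hj) : L j = _) ▸ h1)
  have hlast' : ∀ t, L' (Fin.last n) t = 0 := fun t => by
    have h1 := hL (Fin.last n) t
    rw [show L (Fin.last n) = fun _ => 1 from funext hlast] at h1
    exact h1.unique (hasDerivAt_const t 1)
  set A := ∑ j, γ i (Fin.last n) j * a j with hA
  set B := ∑ j, γ i (Fin.last n) j * b j with hB
  -- The relation with the last index, where the function is 1, expresses `L' i` through the later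
  -- functions, which are affine by induction; so `L i` is at most quadratic.
  have hi' : ∀ t, L' i t = A + B * t := fun t => by
    have h1 := h i _ hil t
    rw [hsum _ hil, hlast, hlast'] at h1
    linarith
  have hquad : ∀ t, L i t = L i 0 + A * t + B * t ^ 2 / 2 := by
    have hd : ∀ t, HasDerivAt (fun t => L i t - (A * t + B * t ^ 2 / 2)) 0 t := fun t => by
      have h1 : HasDerivAt (fun t => A * t + B * t ^ 2 / 2) (A + B * t) t := by
        refine (((hasDerivAt_id' t).const_mul A).fun_add
          ((((hasDerivAt_id' t).fun_pow 2).const_mul B).div_const 2)).congr_deriv ?_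
        simp only [Nat.cast_ofNat]
        ring
      exact ((hL i t).fun_sub h1).congr_deriv (by rw [hi' t, sub_self])
    intro t
    have := is_const_of_deriv_eq_zero (fun t => (hd t).differentiableAt) (fun t => (hd t).deriv) t 0
    simp only [mul_zero] at this
    linarith
  by_cases hB0 : B = 0
  · exact ⟨L i 0, A, fun t => by rw [hquad t, hB0]; ring⟩
  exfalso
  obtain ⟨j, -, hj⟩ := Finset.exists_ne_zero_of_sum_ne_zero (hB ▸ hB0)
  have hij : i < j := by
    by_contra hc
    exact hj (by rw [hγ i _ j hil (not_lt.mp hc), zero_mul])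
  have hbj : b j ≠ 0 := right_ne_zero_of_mul hj
  -- The coefficient of t² is B b_j - b_j B / 2 = B b_j / 2 on the left and 0 on the right. The
  -- second difference at -1, 0, 1 extracts it.
  have h3 : ∀ t, (A + B * t) * (a j + b j * t) - b j * (L i 0 + A * t + B * t ^ 2 / 2) =
      (∑ k, γ i j k * a k) + (∑ k, γ i j k * b k) * t := fun t => by
    rw [← hsum j hij t, ← h i j hij t, hi', hderiv j hij, hab j hij, hquad t]
  have h0 := h3 0
  have h1 := h3 1
  have h2 := h3 (-1)
  exact mul_ne_zero hB0 hbj (by linarith)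

/-! ### Triangular fields projectable along `F` -/

/-- The partial derivative of `F` with respect to the variable with index `j`. -/
def partialDeriv {N : ℕ} (F : (Fin N → ℝ) → ℝ) (j : Fin N) (c : Fin N → ℝ) : ℝ :=
  fderiv ℝ F c (Pi.single j 1)

theorem fderiv_apply_eq_sum {N : ℕ} (F : (Fin N → ℝ) → ℝ) (c v : Fin N → ℝ) :
    fderiv ℝ F c v = ∑ j, v j * partialDeriv F j c := by
  conv_lhs => rw [pi_eq_sum_univ' v]
  simp [partialDeriv, map_sum]

/-- `initialParams` as a continuous linear map. -/
def initialParamsCLM {N : ℕ} (j : Fin N) : (Fin N → ℝ) →L[ℝ] (Fin j → ℝ) :=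
  ContinuousLinearMap.pi fun i => ContinuousLinearMap.proj (Fin.castLE j.isLt.le i)

theorem initialParamsCLM_apply {N : ℕ} (j : Fin N) (c : Fin N → ℝ) :
    initialParamsCLM j c = initialParams j c := rfl

theorem initialParams_congr {N : ℕ} {j : Fin N} {c c' : Fin N → ℝ}
    (h : ∀ i, i < j → c i = c' i) : initialParams j c = initialParams j c' :=
  funext fun i => h _ (by simp [Fin.lt_def])

theorem contDiff_initialParams {N : ℕ} (j : Fin N) {m : WithTop ℕ∞} :
    ContDiff ℝ m (initialParams j) :=
  (initialParamsCLM j).contDiff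

theorem initialParams_single_of_le {N : ℕ} {j l : Fin N} (h : j ≤ l) (t : ℝ) :
    initialParams j (Pi.single l t) = 0 :=
  funext fun i => by
    have : Fin.castLE j.isLt.le i ≠ l := by
      intro h'
      have h1 : (i : ℕ) < j := i.isLt
      have h2 : (i : ℕ) = l := by rw [← h']; rfl
      exact absurd h (not_le.mpr (Fin.lt_def.mpr (h2 ▸ h1)))
    simp [initialParams, this]

theorem initialParams_add_single_last {n : ℕ} (j : Fin (n + 1)) (c : Fin (n + 1) → ℝ) (t : ℝ) :
    initialParams j (c + Pi.single (Fin.last n) t) = initialParams j c := by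
  rw [← initialParamsCLM_apply, map_add, initialParamsCLM_apply, initialParamsCLM_apply,
    initialParams_single_of_le (Fin.le_last j), add_zero]

theorem hasDerivAt_add_single_last {n : ℕ} (c : Fin (n + 1) → ℝ) (t : ℝ) :
    HasDerivAt (fun t => c + Pi.single (Fin.last n) t) (Pi.single (Fin.last n) 1) t := by
  have h : HasDerivAt (fun t => c + t • (Pi.single (Fin.last n) (1 : ℝ) : Fin (n + 1) → ℝ))
      (Pi.single (Fin.last n) 1) t := by
    simpa using ((hasDerivAt_id t).smul_const
      (Pi.single (Fin.last n) (1 : ℝ) : Fin (n + 1) → ℝ)).const_add c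
  simpa [← Pi.single_smul] using h

/-- The function `F` on the line in the direction of the last variable. -/
theorem hasDerivAt_comp_add_single_last {n : ℕ} {F : (Fin (n + 1) → ℝ) → ℝ}
    (hF : Differentiable ℝ F) (c : Fin (n + 1) → ℝ) (t : ℝ) :
    HasDerivAt (fun t => F (c + Pi.single (Fin.last n) t))
      (partialDeriv F (Fin.last n) (c + Pi.single (Fin.last n) t)) t :=
  (hF _).hasFDerivAt.comp_hasDerivAt t (hasDerivAt_add_single_last c t)

/-- A triangular vector field `∑ j, W j ∂_j` on `ℝ^N`: its component `W j` depends only on the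
first `j` variables. -/
abbrev TriangularField (N : ℕ) := (j : Fin N) → (Fin j → ℝ) → ℝ

/-- The triangular field `W` is `C¹` and `F`-related to a `C¹` vector field on the line. -/
def IsProjectable {N : ℕ} (F : (Fin N → ℝ) → ℝ) (W : TriangularField N) : Prop :=
  (∀ j, ContDiff ℝ 1 (W j)) ∧ ∃ k : ℝ → ℝ, ContDiff ℝ 1 k ∧
    ∀ c, ∑ j, W j (initialParams j c) * partialDeriv F j c = k (F c)

/-- If projectable triangular fields form the standard frame at the point `c₀`, then the ratios of
the partial derivatives of `F` to the last one are affine on the line through `c₀` in the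
direction of the last variable. -/
theorem exists_affine_ratio {n : ℕ} {F : (Fin (n + 1) → ℝ) → ℝ} (hF : ContDiff ℝ 2 F)
    (hne : ∀ c, partialDeriv F (Fin.last n) c ≠ 0) (W : Fin (n + 1) → TriangularField (n + 1))
    (hW : ∀ i, IsProjectable F (W i)) (c₀ : Fin (n + 1) → ℝ)
    (hδ : ∀ i j, W i j (initialParams j c₀) = if i = j then 1 else 0) (i : Fin (n + 1)) :
    ∃ α β : ℝ, ∀ t, partialDeriv F i (c₀ + Pi.single (Fin.last n) t) =
      (α + β * t) * partialDeriv F (Fin.last n) (c₀ + Pi.single (Fin.last n) t) := by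
  choose hW1 k hk hkF using hW
  have hFd : ContDiff ℝ 1 (fderiv ℝ F) := hF.fderiv_right (by norm_num)
  have hpd : ∀ j, Differentiable ℝ (partialDeriv F j) := fun j =>
    (hFd.clm_apply contDiff_const).differentiable (by norm_num)
  let c : ℝ → Fin (n + 1) → ℝ := fun t => c₀ + Pi.single (Fin.last n) t
  let D : Fin (n + 1) → Fin (n + 1) → ℝ → ℝ := fun j l t =>
    fderiv ℝ (partialDeriv F j) (c t) (Pi.single l 1)
  have hD : ∀ j l t, D j l t = D l j t := by
    have hform : ∀ j l t, D j l t =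
        fderiv ℝ (fderiv ℝ F) (c t) (Pi.single l 1) (Pi.single j 1) := by
      intro j l t
      have h1 := ((hFd.differentiable (by norm_num) (c t)).hasFDerivAt.clm_apply
        (hasFDerivAt_const (Pi.single j (1 : ℝ) : Fin (n + 1) → ℝ) (c t))).fderiv
      have h2 : D j l t = fderiv ℝ (fun y => fderiv ℝ F y (Pi.single j 1)) (c t)
        (Pi.single l 1) := rfl
      rw [h2, h1]
      simp
    intro j l t
    rw [hform, hform]
    exact (hF.contDiffAt.isSymmSndFDerivAt (by simp)).eq _ _
  let μ : Fin (n + 1) → Fin (n + 1) → Fin (n + 1) → ℝ := fun i j l =>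
    fderiv ℝ (W i j) (initialParams j c₀) (initialParams j (Pi.single l 1))
  have hμ : ∀ i j l, j ≤ l → μ i j l = 0 := fun i j l hjl => by
    simp only [μ, initialParams_single_of_le hjl, map_zero]
  -- No component of a triangular field sees the last variable, so the fields are the standard frame
  -- along the whole line.
  have hc : ∀ j t, initialParams j (c t) = initialParams j c₀ := fun j t =>
    initialParams_add_single_last j c₀ t
  -- This is the identity `∑ W i j ∂_j F = k i ∘ F` differentiated in direction `l` at a point of
  -- the line.
  have key : ∀ i l t, ∑ j, μ i j l * partialDeriv F j (c t) + D i l t =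
      deriv (k i) (F (c t)) * partialDeriv F l (c t) := by
    intro i l t
    have h1 : HasFDerivAt (fun c => ∑ j, W i j (initialParams j c) * partialDeriv F j c)
        (∑ j, (W i j (initialParams j (c t)) • fderiv ℝ (partialDeriv F j) (c t) +
          partialDeriv F j (c t) • (fderiv ℝ (W i j) (initialParams j (c t))).comp
            (initialParamsCLM j))) (c t) := by
      refine HasFDerivAt.fun_sum fun j _ => ?_
      have h2 : HasFDerivAt (fun c => W i j (initialParams j c))
          ((fderiv ℝ (W i j) (initialParams j (c t))).comp (initialParamsCLM j)) (c t) :=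
        (((hW1 i j).differentiable (by norm_num)) _).hasFDerivAt.comp (c t)
          (initialParamsCLM j).hasFDerivAt
      exact h2.mul (hpd j (c t)).hasFDerivAt
    have h3 : HasFDerivAt (fun c => k i (F c)) (deriv (k i) (F (c t)) • fderiv ℝ F (c t)) (c t) :=
      (((hk i).differentiable (by norm_num)) _).hasDerivAt.comp_hasFDerivAt (c t)
        ((hF.differentiable (by norm_num)) (c t)).hasFDerivAt
    rw [show (fun c => ∑ j, W i j (initialParams j c) * partialDeriv F j c) =
      fun c => k i (F c) from funext (hkF i)] at h1
    have h4 := DFunLike.congr_fun (h1.unique h3) (Pi.single l 1)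
    simp only [sum_apply, add_apply, smul_apply, ContinuousLinearMap.comp_apply, initialParamsCLM_apply,
      smul_eq_mul, hc, hδ, Finset.sum_add_distrib, ite_mul, one_mul, zero_mul,
      Finset.sum_ite_eq, Finset.mem_univ, if_true] at h4
    have h5 : ∑ j, μ i j l * partialDeriv F j (c t) = ∑ j, partialDeriv F j (c t) *
        fderiv ℝ (W i j) (initialParams j c₀) (initialParams j (Pi.single l 1)) :=
      Finset.sum_congr rfl fun j _ => mul_comm _ _
    rw [h5, add_comm]
    exact h4
  have keyn : ∀ i t, D i (Fin.last n) t =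
      deriv (k i) (F (c t)) * partialDeriv F (Fin.last n) (c t) := fun i t => by
    rw [← key i (Fin.last n) t, Finset.sum_eq_zero, zero_add]
    exact fun j _ => by rw [hμ i j _ (Fin.le_last j), zero_mul]
  let P : Fin (n + 1) → ℝ → ℝ := fun j t => partialDeriv F j (c t)
  have hP : ∀ j t, HasDerivAt (P j) (D j (Fin.last n) t) t := fun j t =>
    hasDerivAt_comp_add_single_last (hpd j) c₀ t
  have hP0 : ∀ t, P (Fin.last n) t ≠ 0 := fun t => hne _
  -- Antisymmetrizing `key` in `i` and `l` cancels the second derivatives of `F`. By `keyn`, the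
  -- factors `deriv (k i)` left over are those occurring in the derivatives of the ratios.
  obtain ⟨α, β, hαβ⟩ := affine_of_bracket_relations (fun i t => P i t / P (Fin.last n) t)
    (fun i t => (D i (Fin.last n) t * P (Fin.last n) t - P i t * D (Fin.last n) (Fin.last n) t) /
      P (Fin.last n) t ^ 2) (fun i l j => μ i j l - μ l j i)
    (fun i t => (hP i t).div (hP _ t) (hP0 t)) (fun t => div_self (hP0 t))
    (fun i l j hil hji => by rw [hμ i j l (hji.trans hil.le), hμ l j i hji, sub_zero])
    (fun i l _ t => by
      have e1 := key i l t
      have e2 := key l i t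
      have e3 := keyn i t
      have e4 := keyn l t
      have e5 := hD i l t
      change ∑ j, μ i j l * P j t + D i l t = deriv (k i) (F (c t)) * P l t at e1
      change ∑ j, μ l j i * P j t + D l i t = deriv (k l) (F (c t)) * P i t at e2
      change D i (Fin.last n) t = deriv (k i) (F (c t)) * P (Fin.last n) t at e3
      change D l (Fin.last n) t = deriv (k l) (F (c t)) * P (Fin.last n) t at e4
      have e6 : ∑ j, (μ i j l - μ l j i) * (P j t / P (Fin.last n) t) =
          (∑ j, μ i j l * P j t - ∑ j, μ l j i * P j t) / P (Fin.last n) t := by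
        rw [← Finset.sum_sub_distrib, Finset.sum_div]
        exact Finset.sum_congr rfl fun j _ => by ring
      rw [e6, show ∑ j, μ i j l * P j t - ∑ j, μ l j i * P j t =
        deriv (k i) (F (c t)) * P l t - deriv (k l) (F (c t)) * P i t by linarith, e3, e4]
      have := hP0 t
      field_simp
      ring) i
  exact ⟨α, β, fun t => by rw [← hαβ t]; exact (div_mul_cancel₀ _ (hP0 t)).symm⟩

/-! ### Local inverses and functions of `F` -/

open Filter Topology in
theorem exists_contDiffAt_right_inverse {ψ : ℝ → ℝ} {t : ℝ} (hψ : ContDiffAt ℝ 1 ψ t)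
    (hne : deriv ψ t ≠ 0) :
    ∃ r : ℝ → ℝ, ContDiffAt ℝ 1 r (ψ t) ∧ r (ψ t) = t ∧ ∀ᶠ z in 𝓝 (ψ t), ψ (r z) = z := by
  have h : HasFDerivAt ψ
      ((ContinuousLinearEquiv.unitsEquivAut ℝ (Units.mk0 _ hne) : ℝ ≃L[ℝ] ℝ) : ℝ →L[ℝ] ℝ) t :=
    (hψ.differentiableAt (by norm_num)).hasDerivAt.hasFDerivAt_equiv hne
  exact ⟨hψ.localInverse h (by norm_num), hψ.to_localInverse h (by norm_num),
    hψ.localInverse_apply_image h (by norm_num),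
    (hψ.hasStrictFDerivAt' h (by norm_num)).eventually_right_inverse⟩

-- A left inverse on the whole line must agree near ψ(t) with the inverse given by the inverse
-- function theorem, so it inherits its regularity.
open Filter Topology in
theorem contDiffAt_of_leftInverse {ψ g : ℝ → ℝ} (hψ : ContDiff ℝ 1 ψ) (hne : ∀ t, deriv ψ t ≠ 0)
    (hg : ∀ t, g (ψ t) = t) (t : ℝ) :
    ContDiffAt ℝ 1 g (ψ t) ∧ deriv g (ψ t) * deriv ψ t = 1 := by
  obtain ⟨r, hr, -, hr2⟩ := exists_contDiffAt_right_inverse hψ.contDiffAt (hne t)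
  have h : ContDiffAt ℝ 1 g (ψ t) := hr.congr_of_eventuallyEq <| by
    filter_upwards [hr2] with z hz
    conv_lhs => rw [← hz]
    exact hg _
  refine ⟨h, ?_⟩
  have h1 := (h.differentiableAt (by norm_num)).hasDerivAt.comp t
    (hψ.differentiable (by norm_num) t).hasDerivAt
  exact h1.unique ((funext hg : g ∘ ψ = id) ▸ hasDerivAt_id t)

theorem injective_of_hasDerivAt_ne_zero {f f' : ℝ → ℝ} (hf : ∀ x, HasDerivAt f (f' x) x)
    (h0 : ∀ x, f' x ≠ 0) : Function.Injective f := by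
  have key : ∀ a b, a < b → f a ≠ f b := fun a b hab he => by
    obtain ⟨c, -, hc⟩ := exists_hasDerivAt_eq_zero hab
      (fun x _ => (hf x).continuousAt.continuousWithinAt) he (fun x _ => hf x)
    exact h0 c hc
  intro a b hab
  by_contra hne
  rcases lt_or_gt_of_ne hne with h | h
  · exact key a b h hab
  · exact key b a h hab.symm

theorem strictMono_or_strictAnti_of_hasDerivAt_ne_zero {f f' : ℝ → ℝ}
    (hf : ∀ x, HasDerivAt f (f' x) x) (h0 : ∀ x, f' x ≠ 0) : StrictMono f ∨ StrictAnti f :=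
  (continuous_iff_continuousAt.mpr fun x => (hf x).continuousAt).strictMono_of_inj
    (injective_of_hasDerivAt_ne_zero hf h0)

/-- A function which is constant on the level sets of `F`, and `C¹` along the lines in the
direction of the last variable, is a `C¹` function of `F`. -/
theorem exists_contDiff_factor {n : ℕ} {F Y : (Fin (n + 1) → ℝ) → ℝ} (hF : ContDiff ℝ 1 F)
    (hne : ∀ c, partialDeriv F (Fin.last n) c ≠ 0) (hsurj : Function.Surjective F)
    (hY : ∀ c : Fin (n + 1) → ℝ, ContDiff ℝ 1 fun t : ℝ => Y (c + Pi.single (Fin.last n) t))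
    (hYF : ∀ c c', F c = F c' → Y c = Y c') :
    ∃ k : ℝ → ℝ, ContDiff ℝ 1 k ∧ ∀ c, Y c = k (F c) := by
  have hk : ∀ c, Y c = Y (Function.surjInv hsurj (F c)) := fun c =>
    hYF _ _ (Function.surjInv_eq hsurj _).symm
  refine ⟨fun z => Y (Function.surjInv hsurj z), contDiff_iff_contDiffAt.mpr fun z => ?_, hk⟩
  obtain ⟨c, rfl⟩ := hsurj z
  let m : ℝ → ℝ := fun t => F (c + Pi.single (Fin.last n) t)
  have hm : ContDiff ℝ 1 m := hF.comp (contDiff_const.add (contDiff_single (fun _ => ℝ) 1 (Fin.last n)))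
  have hm' := hasDerivAt_comp_add_single_last (hF.differentiable (by norm_num)) c
  have hm0 : m 0 = F c := by simp [m]
  obtain ⟨r, hr, -, hr2⟩ := exists_contDiffAt_right_inverse (t := 0) hm.contDiffAt
    (by rw [(hm' 0).deriv]; exact hne _)
  rw [hm0] at hr hr2
  -- Near F(c) the factor may be computed at any point of the level set; the one on the line through
  -- `c` depends on the level in a C¹ way.
  refine ((hY c).contDiffAt.comp _ hr).congr_of_eventuallyEq ?_
  filter_upwards [hr2] with z hz
  refine hYF _ _ ?_
  rw [Function.surjInv_eq hsurj z]
  exact hz.symm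

/-! ### Flows of triangular fields and affine reparametrization -/

theorem eq_of_hasDerivAt_of_contDiff {k f g : ℝ → ℝ} (hk : ContDiff ℝ 1 k)
    (hf : ∀ t, HasDerivAt f (k (f t)) t) (hg : ∀ t, HasDerivAt g (k (g t)) t) {t₀ : ℝ}
    (h : f t₀ = g t₀) : f = g := by
  funext t
  obtain ⟨a, b, ht₀, ht⟩ : ∃ a b, t₀ ∈ Ioo a b ∧ t ∈ Ioo a b :=
    ⟨min t₀ t - 1, max t₀ t + 1,
      ⟨by linarith [min_le_left t₀ t], by linarith [le_max_left t₀ t]⟩,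
      ⟨by linarith [min_le_right t₀ t], by linarith [le_max_right t₀ t]⟩⟩
  have hfc : Continuous f := continuous_iff_continuousAt.mpr fun x => (hf x).continuousAt
  have hgc : Continuous g := continuous_iff_continuousAt.mpr fun x => (hg x).continuousAt
  obtain ⟨R, hR⟩ := (isCompact_Icc (a := a) (b := b)).exists_bound_of_continuousOn hfc.continuousOn
  obtain ⟨R', hR'⟩ := (isCompact_Icc (a := a) (b := b)).exists_bound_of_continuousOn
    hgc.continuousOn
  obtain ⟨K, hK⟩ := (hk.contDiffOn (s := Icc (-max R R') (max R R'))).exists_lipschitzOnWith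
    (by decide) (convex_Icc _ _) isCompact_Icc
  refine ODE_solution_unique_of_mem_Ioo (v := fun _ => k) (s := fun _ => Icc (-max R R') (max R R'))
    (fun _ _ => hK) ht₀ (fun s hs => ⟨hf s, ?_⟩) (fun s hs => ⟨hg s, ?_⟩) h ht
  · exact abs_le.mp ((hR s (Ioo_subset_Icc_self hs)).trans (le_max_left _ _))
  · exact abs_le.mp ((hR' s (Ioo_subset_Icc_self hs)).trans (le_max_right _ _))

/-- The solution of v' = α + β v is affine in its value v₁ at s₁; `w` is the solution that vanishes
there. This is why flows of affine fields give affine changes of variable. -/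
theorem exists_hasDerivAt_affine (α β s₁ : ℝ) :
    ∃ w : ℝ → ℝ, w s₁ = 0 ∧ ∀ v₁ s, HasDerivAt (fun s => Real.exp (β * (s - s₁)) * v₁ + w s)
      (α + β * (Real.exp (β * (s - s₁)) * v₁ + w s)) s := by
  have hexp : ∀ v₁ s, HasDerivAt (fun s => Real.exp (β * (s - s₁)) * v₁)
      (β * (Real.exp (β * (s - s₁)) * v₁)) s := fun v₁ s => by
    refine ((((hasDerivAt_id' s).sub_const s₁).const_mul β).exp.mul_const v₁).congr_deriv ?_
    ring
  rcases eq_or_ne β 0 with rfl | hβ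
  · refine ⟨fun s => α * (s - s₁), by simp, fun v₁ s => ?_⟩
    refine ((hexp v₁ s).fun_add (((hasDerivAt_id' s).sub_const s₁).const_mul α)).congr_deriv ?_
    ring
  · refine ⟨fun s => Real.exp (β * (s - s₁)) * (α / β) - α / β, by simp, fun v₁ s => ?_⟩
    refine ((hexp v₁ s).fun_add ((hexp (α / β) s).sub_const (α / β))).congr_deriv ?_
    field_simp
    ring

theorem quadrature_congr {N : ℕ} (x₀ : ℝ) (φ : (j : Fin N) → ℝ → (Fin j → ℝ) → ℝ) (j : Fin N)
    (x : ℝ) {c c' : Fin N → ℝ} (h : ∀ i, i < j → c i = c' i) :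
    quadrature x₀ φ j x c = quadrature x₀ φ j x c' := by
  induction j using WellFoundedLT.induction generalizing x with
  | ind j ih =>
  rw [quadrature_eq, quadrature_eq]
  congr 1
  funext t
  congr 1
  refine initialParams_congr fun i hi => ?_
  simp only [shiftedQuadratures]
  rw [ih i hi t fun l hl => h l (hl.trans hi), h i hi]

/-- The last parameter enters no integrand. The resulting commutation with translations makes the
lines in the last direction, on which `F` is strictly monotone, the natural transversals to its
level sets. -/
theorem shiftedQuadratures_add_single_last {n : ℕ} (x₀ : ℝ)
    (φ : (j : Fin (n + 1)) → ℝ → (Fin j → ℝ) → ℝ) (x : ℝ) (c : Fin (n + 1) → ℝ) (t : ℝ) :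
    shiftedQuadratures x₀ φ x (c + Pi.single (Fin.last n) t) =
      shiftedQuadratures x₀ φ x c + Pi.single (Fin.last n) t := by
  funext j
  simp only [shiftedQuadratures, Pi.add_apply]
  rw [quadrature_congr x₀ φ j x (c' := c), add_assoc]
  intro i hi
  simp [(hi.trans_le (Fin.le_last j)).ne]

theorem shiftedQuadratures_self {N : ℕ} (x₀ : ℝ) (φ : (j : Fin N) → ℝ → (Fin j → ℝ) → ℝ)
    (c : Fin N → ℝ) : shiftedQuadratures x₀ φ x₀ c = c := by
  funext j
  simp [shiftedQuadratures, quadrature_eq]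

/-- The flow of a triangular vector field, by quadratures. -/
def triangularFlow {N : ℕ} (W : TriangularField N) (s : ℝ) (c : Fin N → ℝ) : Fin N → ℝ :=
  shiftedQuadratures 0 (fun j _ y => W j y) s c

theorem hasDerivAt_triangularFlow {N : ℕ} {W : TriangularField N} (hW : ∀ j, Continuous (W j))
    (c : Fin N → ℝ) (s : ℝ) :
    HasDerivAt (fun s => triangularFlow W s c)
      (fun j => W j (initialParams j (triangularFlow W s c))) s := by
  rw [hasDerivAt_pi]
  intro j
  induction j using WellFoundedLT.induction generalizing s with
  | ind j ih =>
  have hcont : Continuous fun t => W j (initialParams j (triangularFlow W t c)) := by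
    refine (hW j).comp (continuous_pi fun i => ?_)
    exact continuous_iff_continuousAt.mpr fun t =>
      (ih (Fin.castLE j.isLt.le i) i.isLt t).continuousAt
  have h : (fun s => triangularFlow W s c j) =
      fun s => (∫ t in 0..s, W j (initialParams j (triangularFlow W t c))) + c j := by
    funext s
    rw [triangularFlow, shiftedQuadratures, quadrature_eq]
    rfl
  rw [h]
  exact (hcont.integral_hasStrictDerivAt 0 s).hasDerivAt.add_const _

/-- While the coordinates below `m` equal those of `c₀`, the components up to `m` are those of ∂_m.
The flow thus adjusts coordinate `m` at unit speed without disturbing the earlier ones. -/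
theorem triangularFlow_of_frame {N : ℕ} {W : TriangularField N} {c c₀ : Fin N → ℝ} {m : Fin N}
    (hc : ∀ l, l < m → c l = c₀ l)
    (hδ : ∀ j, W j (initialParams j c₀) = if m = j then 1 else 0) (s : ℝ) :
    (∀ l, l < m → triangularFlow W s c l = c₀ l) ∧ triangularFlow W s c m = c m + s := by
  have h1 : ∀ l, l < m → ∀ s, triangularFlow W s c l = c₀ l := by
    intro l hl
    induction l using WellFoundedLT.induction with
    | ind l ih =>
    intro s
    have h : ∀ t, initialParams l (triangularFlow W t c) = initialParams l c₀ := fun t =>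
      initialParams_congr fun i hi => ih i hi (hi.trans hl) t
    rw [triangularFlow, shiftedQuadratures, quadrature_eq, ← hc l hl]
    simp only [triangularFlow] at h
    simp [h, hδ, hl.ne']
  refine ⟨fun l hl => h1 l hl s, ?_⟩
  have h : ∀ t, initialParams m (triangularFlow W t c) = initialParams m c₀ := fun t =>
    initialParams_congr fun i hi => h1 i hi t
  rw [triangularFlow, shiftedQuadratures, quadrature_eq]
  simp only [triangularFlow] at h
  simp [h, hδ, add_comm]

/-- If projectable triangular fields form the standard frame at `c₀`, then on every line in the
direction of the last variable `F` coincides, up to an affine change of the variable, with its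
restriction to the line through `c₀`. -/
theorem exists_affine_reparametrization {n : ℕ} {F : (Fin (n + 1) → ℝ) → ℝ} (hF : ContDiff ℝ 2 F)
    (hne : ∀ c, partialDeriv F (Fin.last n) c ≠ 0) (W : Fin (n + 1) → TriangularField (n + 1))
    (hW : ∀ i, IsProjectable F (W i)) (c₀ : Fin (n + 1) → ℝ)
    (hδ : ∀ i j, W i j (initialParams j c₀) = if i = j then 1 else 0) (c : Fin (n + 1) → ℝ) :
    ∃ a b : ℝ, a ≠ 0 ∧ ∀ t, F (c + Pi.single (Fin.last n) t) =
      F (c₀ + Pi.single (Fin.last n) (a * t + b)) := by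
  have hFd : Differentiable ℝ F := hF.differentiable (by norm_num)
  -- Here `d` counts the coordinates, other than the last, not yet matched with `c₀`. For `d = 0`
  -- the two lines coincide up to a translation.
  suffices H : ∀ d m, m + d = n → ∀ c : Fin (n + 1) → ℝ, (∀ l : Fin (n + 1), l.val < m → c l = c₀ l) →
      ∃ a b : ℝ, a ≠ 0 ∧ ∀ t, F (c + Pi.single (Fin.last n) t) =
        F (c₀ + Pi.single (Fin.last n) (a * t + b)) from
    H n 0 (zero_add n) c fun l hl => absurd hl (Nat.not_lt_zero _)
  intro d
  induction d with
  | zero =>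
    intro m hm c hc
    refine ⟨1, c (Fin.last n) - c₀ (Fin.last n), one_ne_zero, fun t => ?_⟩
    congr 1
    funext l
    rcases eq_or_ne l (Fin.last n) with rfl | hl
    · simp only [Pi.add_apply, Pi.single_eq_same]
      ring
    · have : l.val < m := by
        have h1 := lt_of_le_of_ne (Fin.le_last l) hl
        rw [Fin.lt_def, Fin.val_last] at h1
        omega
      simp [hl, hc l this]
  | succ d ih =>
    intro m hm c hc
    let i : Fin (n + 1) := ⟨m, by omega⟩
    let T : ℝ := c₀ i - c i
    obtain ⟨hW1, k, hk, hkF⟩ := hW i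
    have hflow := fun s => triangularFlow_of_frame (m := i) (fun l hl => hc l hl) (hδ i) s
    obtain ⟨a, b, ha, hab⟩ := ih (m + 1) (by omega) (triangularFlow (W i) T c) fun l hl => by
      rcases Nat.lt_succ_iff_lt_or_eq.mp hl with h | h
      · exact (hflow T).1 l h
      · obtain rfl : l = i := Fin.ext h
        rw [(hflow T).2]
        exact add_sub_cancel _ _
    obtain ⟨α, β, hαβ⟩ := exists_affine_ratio hF hne W hW c₀ hδ i
    obtain ⟨w, hw, hwd⟩ := exists_hasDerivAt_affine α β T
    -- The flow of `W i` for time `T` matches coordinate `i`. The induction hypothesis applies at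
    -- time `T`, and the affine flow of the line is followed back to time 0.
    refine ⟨Real.exp (β * (0 - T)) * a, Real.exp (β * (0 - T)) * b + w 0,
      mul_ne_zero (Real.exp_ne_zero _) ha, fun t => ?_⟩
    have hkψ : ∀ u, k (F (c₀ + Pi.single (Fin.last n) u)) =
        (α + β * u) * partialDeriv F (Fin.last n) (c₀ + Pi.single (Fin.last n) u) := fun u => by
      rw [← hkF, ← hαβ u]
      simp [initialParams_add_single_last, hδ]
    have h1 : ∀ s, HasDerivAt
        (fun s => F (triangularFlow (W i) s (c + Pi.single (Fin.last n) t)))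
        (k (F (triangularFlow (W i) s (c + Pi.single (Fin.last n) t)))) s := fun s => by
      refine ((hFd _).hasFDerivAt.comp_hasDerivAt s
        (hasDerivAt_triangularFlow (fun j => (hW1 j).continuous) _ s)).congr_deriv ?_
      rw [fderiv_apply_eq_sum, ← hkF]
    have h2 : ∀ s, HasDerivAt (fun s => F (c₀ + Pi.single (Fin.last n)
          (Real.exp (β * (s - T)) * (a * t + b) + w s)))
        (k (F (c₀ + Pi.single (Fin.last n) (Real.exp (β * (s - T)) * (a * t + b) + w s)))) s := by
      intro s
      refine ((hasDerivAt_comp_add_single_last hFd c₀ _).comp s (hwd (a * t + b) s)).congr_deriv ?_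
      rw [hkψ, mul_comm]
    -- Both curves solve z' = k(z). They agree at time `T` because the flow commutes with
    -- translations of the last variable.
    have h3 := congrFun (eq_of_hasDerivAt_of_contDiff hk h1 h2 (t₀ := T) (by
      simp only [triangularFlow] at hab ⊢
      rw [shiftedQuadratures_add_single_last, hab, hw]
      simp)) 0
    simp only [triangularFlow, shiftedQuadratures_self] at h3
    rw [h3]
    congr 3
    ring

/-! ### Measurability of the quadratures and density of good points -/

/-- A triangular shear of `ℝ^N` preserves the volume. -/
theorem measurePreserving_triangular {N : ℕ} (s : Fin N → (Fin N → ℝ) → ℝ)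
    (hs : ∀ j, Measurable (s j))
    (htri : ∀ j c c', (∀ i, i < j → c i = c' i) → s j c = s j c') :
    MeasurePreserving (fun c : Fin N → ℝ => fun j => s j c + c j) := by
  induction N with
  | zero =>
    rw [show (fun c : Fin 0 → ℝ => fun j => s j c + c j) = id from
      funext fun c => Subsingleton.elim _ _]
    exact MeasurePreserving.id _
  | succ n ih =>
    -- The value 0 of the last coordinate is arbitrary: by `htri` no shift depends on it.
    let s' : Fin n → (Fin n → ℝ) → ℝ := fun j c => s j.castSucc (Fin.snoc c 0)
    have hsnoc : ∀ r : ℝ, Measurable fun c : Fin n → ℝ => (Fin.snoc c r : Fin (n + 1) → ℝ) :=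
      fun r => measurable_pi_iff.mpr fun j => by
        refine Fin.lastCases ?_ (fun j => ?_) j
        · simp
        · simpa using measurable_pi_apply j
    have ih' := ih s' (fun j => (hs _).comp (hsnoc 0)) fun j c c' h => htri _ _ _ fun i hi => by
      have hi' : i.val < n := lt_trans (Fin.lt_def.mp hi) j.isLt
      obtain ⟨i, rfl⟩ : ∃ l : Fin n, i = l.castSucc := ⟨⟨i.val, hi'⟩, rfl⟩
      rw [Fin.snoc_castSucc, Fin.snoc_castSucc]
      exact h _ hi
    have hskew : MeasurePreserving
        (fun p : (Fin n → ℝ) × ℝ => ((fun j => s' j p.1 + p.1 j : Fin n → ℝ),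
          s (Fin.last n) (Fin.snoc p.1 0) + p.2)) (volume.prod volume) (volume.prod volume) :=
      ih'.skew_product (g := fun c t => s (Fin.last n) (Fin.snoc c 0) + t)
        (((hs _).comp ((hsnoc 0).comp measurable_fst)).add measurable_snd)
        (Filter.Eventually.of_forall fun c => map_add_left_eq_self volume _)
    have he := volume_preserving_piFinSuccAbove (fun _ : Fin (n + 1) => ℝ) (Fin.last n)
    have hswap : MeasurePreserving (Prod.swap : (ℝ × (Fin n → ℝ)) → (Fin n → ℝ) × ℝ)
      (volume.prod volume) (volume.prod volume) := Measure.measurePreserving_swap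
    have hswap' : MeasurePreserving (Prod.swap : ((Fin n → ℝ) × ℝ) → ℝ × (Fin n → ℝ))
      (volume.prod volume) (volume.prod volume) := Measure.measurePreserving_swap
    have hT := ((he.symm).comp (hswap'.comp (hskew.comp (hswap.comp he))))
    convert hT using 1
    funext c
    have hc : ∀ j : Fin (n + 1), s j c =
        s j (Fin.snoc (fun i : Fin n => c i.castSucc) 0 : Fin (n + 1) → ℝ) := fun j =>
      htri _ _ _ fun i hi => by
        have hi' : i.val < n := lt_of_lt_of_le (Fin.lt_def.mp hi) (Nat.lt_succ_iff.mp j.isLt)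
        obtain ⟨i, rfl⟩ : ∃ l : Fin n, i = l.castSucc := ⟨⟨i.val, hi'⟩, rfl⟩
        rw [Fin.snoc_castSucc]
    have hrem : (fun i : Fin n => c i.castSucc) = (Fin.last n).removeNth c := by
      funext i
      simp [Fin.removeNth]
    funext j
    refine Fin.lastCases ?_ (fun j => ?_) j
    · rw [hc, hrem]
      simp [MeasurableEquiv.piFinSuccAbove, Fin.insertNthEquiv]
    · rw [hc, hrem]
      simp [MeasurableEquiv.piFinSuccAbove, Fin.insertNthEquiv, s', Fin.init]

open Filter Topology in
/-- A function which is measurable in the first variable and continuous in the second is jointly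
measurable after restriction of the first variable to a measurable set of full measure. -/
theorem exists_measurable_indicator {E : Type*} [TopologicalSpace E]
    [TopologicalSpace.MetrizableSpace E] [MeasurableSpace E] [SecondCountableTopology E]
    [OpensMeasurableSpace E] [Nonempty E]
    {I : Set ℝ} (hI : MeasurableSet I) (f : ℝ → E → ℝ)
    (hf : ∀ c, AEStronglyMeasurable (fun t => f t c) (volume.restrict I))
    (hfc : ∀ t ∈ I, Continuous (f t)) :
    ∃ X ⊆ I, MeasurableSet X ∧ (∀ᵐ t ∂volume.restrict I, t ∈ X) ∧ ∀ X' ⊆ X, MeasurableSet X' →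
      Measurable fun p : ℝ × E => X'.indicator (fun t => f t p.2) p.1 := by
  let q := TopologicalSpace.denseSeq E
  -- A single null set serves a countable dense set of parameters; continuity in the parameter then
  -- reaches all of them.
  have hae : ∀ᵐ t ∂volume.restrict I, ∀ k, f t (q k) = (hf (q k)).mk _ t :=
    ae_all_iff.mpr fun k => (hf (q k)).ae_eq_mk
  obtain ⟨Z, hZ, hZm, hZq⟩ := hae.exists_measurable_mem
  refine ⟨Z ∩ I, inter_subset_right, hZm.inter hI, ?_, fun X' hX' hX'm => ?_⟩
  · filter_upwards [hZ, ae_restrict_mem hI] with t h1 h2 using ⟨h1, h2⟩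
  have hq : ∀ k, Measurable fun t => X'.indicator (fun t => f t (q k)) t := fun k => by
    have : (fun t => X'.indicator (fun t => f t (q k)) t) = X'.indicator ((hf (q k)).mk _) := by
      refine indicator_congr fun t ht => hZq t (hX' ht).1 k
    rw [this]
    exact (hf (q k)).stronglyMeasurable_mk.measurable.indicator hX'm
  have hcont : ∀ t, Continuous fun c => X'.indicator (fun t => f t c) t := fun t => by
    by_cases ht : t ∈ X'
    · rw [show (fun c => X'.indicator (fun t => f t c) t) = f t from
        funext fun c => indicator_of_mem ht _]
      exact hfc t (hX' ht).2
    · rw [show (fun c => X'.indicator (fun t => f t c) t) = fun _ => 0 from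
        funext fun c => indicator_of_notMem ht _]
      exact continuous_const
  have hall : ∀ c, Measurable fun t => X'.indicator (fun t => f t c) t := fun c => by
    obtain ⟨u, hu, huc⟩ := mem_closure_iff_seq_limit.mp
      ((TopologicalSpace.denseRange_denseSeq E).closure_range ▸ mem_univ c : c ∈ closure (range q))
    choose k hk using hu
    refine measurable_of_tendsto_metrizable (fun m => hq (k m)) ?_
    rw [tendsto_pi_nhds]
    intro t
    refine (((hcont t).tendsto c).comp huc).congr fun m => ?_
    exact congrArg (fun c => X'.indicator (fun t => f t c) t) (hk m).symm
  have h1 := measurable_uncurry_of_continuous_of_measurable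
    (u := fun (c : E) (t : ℝ) => X'.indicator (fun t => f t c) t) hcont hall
  exact h1.comp measurable_swap

/-- The quadratures are jointly measurable in `x` and the parameters if the integrands are. -/
theorem measurable_shiftedQuadratures {N : ℕ} (x₀ : ℝ)
    {φ : (j : Fin N) → ℝ → (Fin j → ℝ) → ℝ}
    (hφ : ∀ j : Fin N, Measurable fun p : ℝ × (Fin j → ℝ) => φ j p.1 p.2) (j : Fin N) :
    Measurable fun p : ℝ × (Fin N → ℝ) => shiftedQuadratures x₀ φ p.1 p.2 j := by
  induction j using WellFoundedLT.induction with
  | ind j ih =>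
  have h1 : Measurable fun p : ℝ × (Fin N → ℝ) =>
      φ j p.1 (initialParams j (shiftedQuadratures x₀ φ p.1 p.2)) :=
    (hφ j).comp (measurable_fst.prodMk (measurable_pi_iff.mpr fun i => ih _ i.isLt))
  have h2 : ∀ S : Set ((ℝ × (Fin N → ℝ)) × ℝ), MeasurableSet S →
      Measurable fun p : ℝ × (Fin N → ℝ) => ∫ t : ℝ, S.indicator (fun w : (ℝ × (Fin N → ℝ)) × ℝ =>
        φ j w.2 (initialParams j (shiftedQuadratures x₀ φ w.2 w.1.2))) (p, t) := fun S hS => by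
    have h3 : Measurable fun w : (ℝ × (Fin N → ℝ)) × ℝ =>
        φ j w.2 (initialParams j (shiftedQuadratures x₀ φ w.2 w.1.2)) :=
      h1.comp (measurable_snd.prodMk (measurable_snd.comp measurable_fst))
    exact (h3.indicator hS).stronglyMeasurable.integral_prod_right'.measurable
  have hS1 : MeasurableSet {w : (ℝ × (Fin N → ℝ)) × ℝ | w.2 ∈ Ioc x₀ w.1.1} :=
    (measurableSet_lt measurable_const measurable_snd).inter
      (measurableSet_le measurable_snd (measurable_fst.comp measurable_fst))
  have hS2 : MeasurableSet {w : (ℝ × (Fin N → ℝ)) × ℝ | w.2 ∈ Ioc w.1.1 x₀} :=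
    (measurableSet_lt (measurable_fst.comp measurable_fst) measurable_snd).inter
      (measurableSet_le measurable_snd measurable_const)
  have h4 := ((h2 _ hS1).sub (h2 _ hS2)).add
    ((measurable_pi_apply j).comp (measurable_snd (α := ℝ) (β := Fin N → ℝ)))
  convert h4 using 1
  funext p
  rw [shiftedQuadratures, quadrature_eq, intervalIntegral, ← integral_indicator measurableSet_Ioc,
    ← integral_indicator measurableSet_Ioc]
  rfl

theorem intervalIntegrable_of_locallyIntegrableOn {I : Set ℝ} (hI : I.OrdConnected) {g : ℝ → ℝ}
    (hg : LocallyIntegrableOn g I) {a b : ℝ} (ha : a ∈ I) (hb : b ∈ I) :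
    IntervalIntegrable g volume a b :=
  (hg.integrableOn_compact_subset (hI.uIcc_subset ha hb) isCompact_uIcc).intervalIntegrable

theorem ae_hasDerivAt_integral_of_locallyIntegrableOn {I : Set ℝ} (hI : I.OrdConnected)
    {g : ℝ → ℝ} (hg : LocallyIntegrableOn g I) {x₀ : ℝ} (hx₀ : x₀ ∈ I) :
    ∀ᵐ x ∂volume.restrict I, HasDerivAt (fun x => ∫ t in x₀..x, g t) (g x) x := by
  refine ae_restrict_of_ae_restrict_inter_Ioo fun a b ha hb hab => ?_
  have ha' : min a x₀ ∈ I := by rcases min_choice a x₀ with h | h <;> rwa [h]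
  have hb' : max b x₀ ∈ I := by rcases max_choice b x₀ with h | h <;> rwa [h]
  have h := (intervalIntegrable_of_locallyIntegrableOn hI hg ha' hb').ae_hasDerivAt_integral
  rw [ae_restrict_iff' (hI.measurableSet.inter measurableSet_Ioo)]
  filter_upwards [h] with x hx hxm
  have hle : min a x₀ ≤ max b x₀ := (min_le_right _ _).trans (le_max_right _ _)
  rw [uIcc_of_le hle] at hx
  exact hx ⟨(min_le_left _ _).trans hxm.2.1.le, hxm.2.2.le.trans (le_max_left _ _)⟩ x₀
    ⟨min_le_right _ _, le_max_right _ _⟩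

theorem ae_restrict_mem_interior {I : Set ℝ} (hI : I.OrdConnected) :
    ∀ᵐ x ∂volume.restrict I, x ∈ interior I := by
  rw [ae_restrict_iff' hI.measurableSet]
  have h := hI.convex.addHaar_frontier volume
  filter_upwards [measure_eq_zero_iff_ae_notMem.mp h] with x hx hxI
  by_contra hc
  exact hx ⟨subset_closure hxI, hc⟩

theorem ae_hasDerivAt_shiftedQuadratures {N : ℕ} {I : Set ℝ} (hI : I.OrdConnected) {x₀ : ℝ}
    (hx₀ : x₀ ∈ I) {φ : (j : Fin N) → ℝ → (Fin j → ℝ) → ℝ} (hφ : IsQuadratureSystem I x₀ φ)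
    (c : Fin N → ℝ) : ∀ᵐ x ∂volume.restrict I, HasDerivAt (fun x => shiftedQuadratures x₀ φ x c)
      (fun j => φ j x (initialParams j (shiftedQuadratures x₀ φ x c))) x := by
  simp only [hasDerivAt_pi]
  rw [ae_all_iff]
  intro j
  filter_upwards [ae_hasDerivAt_integral_of_locallyIntegrableOn hI (hφ.integrable j c) hx₀]
    with x hx
  simp only [shiftedQuadratures, quadrature_eq]
  exact hx.add_const _

open Filter Topology in
/-- For almost every `x`, the points `S(x, c)` such that the difference quotients of the
quadratures at `x` with the parameters `c` converge to the integrands are dense. -/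
theorem ae_dense_tendsto_quotient {N : ℕ} {I : Set ℝ} (hI : I.OrdConnected) {x₀ : ℝ}
    (hx₀ : x₀ ∈ I) {φ : (j : Fin N) → ℝ → (Fin j → ℝ) → ℝ} (hφ : IsQuadratureSystem I x₀ φ) :
    ∀ᵐ x ∂volume.restrict I, Dense (shiftedQuadratures x₀ φ x '' {c | ∀ j,
      Tendsto (fun k : ℕ => ((k : ℝ) + 1) * (shiftedQuadratures x₀ φ (x + 1 / ((k : ℝ) + 1)) c j -
        shiftedQuadratures x₀ φ x c j)) atTop
        (𝓝 (φ j x (initialParams j (shiftedQuadratures x₀ φ x c))))}) := by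
  have hIm := hI.measurableSet
  choose X hXI hXm hXae hX using fun j : Fin N => exists_measurable_indicator hIm (φ j)
    (fun c => (hφ.locallyIntegrable j c).aestronglyMeasurable)
    (fun t ht => (hφ.contDiff j t ht).continuous)
  let Z : Set ℝ := I ∩ ⋂ j, X j
  have hZm : MeasurableSet Z := hIm.inter (MeasurableSet.iInter hXm)
  have hZae : ∀ᵐ t ∂volume.restrict I, t ∈ Z := by
    filter_upwards [ae_all_iff.mpr hXae, ae_restrict_mem hIm] with t h1 h2
    exact ⟨h2, mem_iInter.mpr h1⟩
  -- Cutting off the integrands on a null set makes them jointly measurable and leaves the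
  -- quadratures on `I` unchanged.
  let φ' : (j : Fin N) → ℝ → (Fin j → ℝ) → ℝ := fun j t y => Z.indicator (fun t => φ j t y) t
  have hφ' : ∀ j : Fin N, Measurable fun p : ℝ × (Fin j → ℝ) => φ' j p.1 p.2 := fun j =>
    hX j Z (fun t ht => mem_iInter.mp ht.2 j) hZm
  have hS : ∀ j, ∀ x ∈ I, ∀ c, shiftedQuadratures x₀ φ' x c j = shiftedQuadratures x₀ φ x c j := by
    intro j
    induction j using WellFoundedLT.induction with
    | ind j ih =>
    intro x hx c
    simp only [shiftedQuadratures, quadrature_eq]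
    congr 1
    refine intervalIntegral.integral_congr_ae ?_
    have h1 := (ae_restrict_iff' hIm).mp hZae
    filter_upwards [h1] with t ht htx
    have htI : t ∈ I := hI.uIcc_subset hx₀ hx (uIoc_subset_uIcc htx)
    rw [show initialParams j (shiftedQuadratures x₀ φ' t c) =
      initialParams j (shiftedQuadratures x₀ φ t c) from
      initialParams_congr fun i hi => ih i hi t htI c]
    exact indicator_of_mem (ht htI) _
  have hSm := measurable_shiftedQuadratures x₀ hφ'
  -- Convergence along the one sequence 1 / (k + 1), rather than differentiability, is evidently
  -- measurable in (x, c) and suffices to identify the integrands.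
  let P : ℝ → (Fin N → ℝ) → Prop := fun x c => ∀ j,
    Tendsto (fun k : ℕ => ((k : ℝ) + 1) * (shiftedQuadratures x₀ φ' (x + 1 / ((k : ℝ) + 1)) c j -
        shiftedQuadratures x₀ φ' x c j)) atTop
        (𝓝 (φ' j x (initialParams j (shiftedQuadratures x₀ φ' x c))))
  have hPm : MeasurableSet {p : ℝ × (Fin N → ℝ) | P p.1 p.2} := by
    simp only [P, ofPred_forall]
    refine MeasurableSet.iInter fun j => measurableSet_tendsto_fun (fun k => ?_) ?_
    · have h1 : Measurable fun p : ℝ × (Fin N → ℝ) =>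
          shiftedQuadratures x₀ φ' (p.1 + 1 / ((k : ℝ) + 1)) p.2 j :=
        (hSm j).comp ((measurable_fst.add_const _).prodMk measurable_snd)
      exact (h1.sub (hSm j)).const_mul _
    · exact (hφ' j).comp (measurable_fst.prodMk (measurable_pi_iff.mpr fun i => hSm _))
  have hinv : Tendsto (fun k : ℕ => 1 / ((k : ℝ) + 1)) atTop (𝓝 0) :=
    tendsto_one_div_add_atTop_nhds_zero_nat
  have hPQ : ∀ x ∈ Z, x ∈ interior I → ∀ c, P x c ↔ ∀ j,
      Tendsto (fun k : ℕ => ((k : ℝ) + 1) * (shiftedQuadratures x₀ φ (x + 1 / ((k : ℝ) + 1)) c j -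
        shiftedQuadratures x₀ φ x c j)) atTop
        (𝓝 (φ j x (initialParams j (shiftedQuadratures x₀ φ x c)))) := by
    intro x hxZ hxi c
    have hxI : x ∈ I := hxZ.1
    have hmem : ∀ᶠ k : ℕ in atTop, x + 1 / ((k : ℝ) + 1) ∈ I := by
      have h3 : Tendsto (fun k : ℕ => x + 1 / ((k : ℝ) + 1)) atTop (𝓝 x) := by
        simpa using hinv.const_add x
      exact h3.eventually (mem_interior_iff_mem_nhds.mp hxi)
    refine forall_congr' fun j => ?_
    have h4 : φ' j x (initialParams j (shiftedQuadratures x₀ φ' x c)) =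
        φ j x (initialParams j (shiftedQuadratures x₀ φ x c)) := by
      rw [show initialParams j (shiftedQuadratures x₀ φ' x c) =
        initialParams j (shiftedQuadratures x₀ φ x c) from
        initialParams_congr fun i hi => hS i x hxI c]
      exact indicator_of_mem hxZ _
    rw [h4]
    refine tendsto_congr' ?_
    filter_upwards [hmem] with k hk
    rw [hS j _ hk, hS j _ hxI]
  have hP : ∀ c, ∀ᵐ x ∂volume.restrict I, P x c := fun c => by
    filter_upwards [ae_hasDerivAt_shiftedQuadratures hI hx₀ hφ c, hZae,
      ae_restrict_mem_interior hI] with x hx hxZ hxi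
    rw [hPQ x hxZ hxi c]
    intro j
    have h2 := ((hasDerivAt_pi.mp hx) j).hasFDerivAt.hasFDerivWithinAt (s := univ) |>.lim
      (c := fun k : ℕ => (k : ℝ) + 1) (v := 1) hinv (Eventually.of_forall fun _ => mem_univ _)
      (by
        refine tendsto_const_nhds.congr fun k => ?_
        have : (k : ℝ) + 1 ≠ 0 := by positivity
        simp [this])
    simpa only [ContinuousLinearMap.toSpanSingleton_apply, smul_eq_mul, one_mul] using h2
  -- Fubini: "for every c, for a.e. x" becomes "for a.e. x, for a.e. c".
  have hae := (Measure.ae_ae_comm (μ := volume.restrict I) (ν := volume) hPm).mpr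
    (Eventually.of_forall hP)
  filter_upwards [hae, hZae, ae_restrict_mem_interior hI] with x hx hxZ hxi
  have hxI : x ∈ I := hxZ.1
  have hmp := measurePreserving_triangular (fun j c => quadrature x₀ φ' j x c)
    (fun j => by
      have h1 : Measurable fun c => shiftedQuadratures x₀ φ' x c j - c j :=
        ((hSm j).comp (measurable_prodMk_left (x := x))).sub (measurable_pi_apply j)
      simpa [shiftedQuadratures] using h1)
    (fun j c c' h => quadrature_congr x₀ φ' j x h)
  -- An open set free of good points S(x, c) would have a null preimage under the volume-preserving
  -- map S(x, ·).
  rw [dense_iff_inter_open]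
  rintro U hU hne
  by_contra hempty
  have hnull : volume ((fun c : Fin N → ℝ => fun j => quadrature x₀ φ' j x c + c j) ⁻¹' U) = 0 := by
    have h0 : volume {c | ¬P x c} = 0 := ae_iff.mp hx
    refine measure_mono_null (fun c hc => mem_ofPred_eq ▸ fun hPc => hempty ?_) h0
    refine ⟨shiftedQuadratures x₀ φ x c, ?_, c, (hPQ x hxZ hxi c).mp hPc, rfl⟩
    rw [← show shiftedQuadratures x₀ φ' x c = _ from funext fun j => hS j x hxI c]
    exact hc
  rw [hmp.measure_preimage hU.measurableSet.nullMeasurableSet] at hnull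
  exact (hU.measure_pos volume hne).ne' hnull

/-! ### Projectability of the integrands -/

open Filter Topology in
/-- Let `Y` be constant on the intersections of the level sets of `F` with the union of a dense
family of lines in the direction of the last variable. Then it is constant on the level sets. -/
theorem eq_of_eq_of_dense {n : ℕ} {F Y : (Fin (n + 1) → ℝ) → ℝ} (hF : Differentiable ℝ F)
    (hne : ∀ c, partialDeriv F (Fin.last n) c ≠ 0) (hY : Continuous Y)
    {D : Set (Fin (n + 1) → ℝ)} (hD : Dense D)
    (h : ∀ C ∈ D, ∀ B ∈ D, ∀ t, F C = F (B + Pi.single (Fin.last n) t) →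
      Y C = Y (B + Pi.single (Fin.last n) t)) {C B : Fin (n + 1) → ℝ} (hCB : F C = F B) :
    Y C = Y B := by
  have hFc := hF.continuous
  have hadd : Continuous fun p : (Fin (n + 1) → ℝ) × ℝ => p.1 + Pi.single (Fin.last n) p.2 :=
    continuous_fst.add ((continuous_single (Fin.last n)).comp continuous_snd)
  refine eq_of_forall_dist_le fun ε hε => ?_
  have h1 : ∀ᶠ p : (Fin (n + 1) → ℝ) × ℝ in 𝓝 B ×ˢ 𝓝 0,
      dist (Y (p.1 + Pi.single (Fin.last n) p.2)) (Y B) < ε / 2 := by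
    rw [← nhds_prod_eq]
    have h2 : Tendsto (fun p : (Fin (n + 1) → ℝ) × ℝ => Y (p.1 + Pi.single (Fin.last n) p.2))
        (𝓝 (B, 0)) (𝓝 (Y B)) := by
      simpa [Function.comp_def] using (hY.comp hadd).tendsto (B, (0 : ℝ))
    exact h2.eventually (Metric.ball_mem_nhds _ (half_pos hε))
  obtain ⟨p₁, hp₁, p₂, hp₂, hp⟩ := eventually_prod_iff.mp h1
  obtain ⟨δ, hδ, hδp⟩ := Metric.eventually_nhds_iff_ball.mp hp₂
  have hδ2 : 0 < δ / 2 := half_pos hδ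
  let g : (Fin (n + 1) → ℝ) → (Fin (n + 1) → ℝ) → ℝ → ℝ := fun C' B' t =>
    F (B' + Pi.single (Fin.last n) t) - F C'
  -- Points of `D` near `C` and `B` need not lie on a common level. The sign change persists for
  -- them, so the intermediate value theorem corrects this by a small shift along the line.
  have hsign : g C B (-(δ / 2)) * g C B (δ / 2) < 0 := by
    have hB0 : F C = F (B + Pi.single (Fin.last n) 0) := by simpa using hCB
    simp only [g, hB0]
    rcases strictMono_or_strictAnti_of_hasDerivAt_ne_zero
      (hasDerivAt_comp_add_single_last hF B) (fun t => hne _) with hm | hm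
    · exact mul_neg_of_neg_of_pos (sub_neg.mpr (hm (by linarith))) (sub_pos.mpr (hm hδ2))
    · exact mul_neg_of_pos_of_neg (sub_pos.mpr (hm (by linarith))) (sub_neg.mpr (hm hδ2))
  have hgc : ∀ t, Continuous fun p : (Fin (n + 1) → ℝ) × (Fin (n + 1) → ℝ) => g p.1 p.2 t :=
    fun t => (hFc.comp (continuous_snd.add continuous_const)).sub (hFc.comp continuous_fst)
  have h3 : ∀ᶠ p in 𝓝 (C, B), g p.1 p.2 (-(δ / 2)) * g p.1 p.2 (δ / 2) < 0 :=
    (((hgc _).mul (hgc _)).tendsto (C, B)).eventually (gt_mem_nhds hsign)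
  have h4 : ∀ᶠ p in 𝓝 (C, B), p₁ p.2 := (continuous_snd.tendsto (C, B)).eventually hp₁
  have h5 : ∀ᶠ p in 𝓝 (C, B), dist (Y p.1) (Y C) < ε / 2 :=
    ((hY.comp continuous_fst).tendsto (C, B)).eventually (Metric.ball_mem_nhds _ (half_pos hε))
  obtain ⟨⟨C', B'⟩, ⟨⟨hs, hp1⟩, hYC⟩, hC', hB'⟩ :=
    mem_closure_iff_nhds.mp ((hD.prod hD) (C, B)) _ ((h3.and h4).and h5)
  obtain ⟨t, ht, htz⟩ : ∃ t ∈ Icc (-(δ / 2)) (δ / 2), g C' B' t = 0 := by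
    have hcont : Continuous (g C' B') :=
      (hFc.comp (continuous_const.add (continuous_single (Fin.last n)))).sub continuous_const
    have hle : -(δ / 2) ≤ δ / 2 := by linarith
    rcases mul_neg_iff.mp hs with h6 | h6
    · exact intermediate_value_Icc' hle hcont.continuousOn ⟨h6.2.le, h6.1.le⟩
    · exact intermediate_value_Icc hle hcont.continuousOn ⟨h6.1.le, h6.2.le⟩
  have h7 := h C' hC' B' hB' t (sub_eq_zero.mp htz).symm
  have h8 := hp hp1 (hδp t (by
    rw [Metric.mem_ball, Real.dist_0_eq_abs, abs_lt]
    constructor <;> linarith [ht.1, ht.2]))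
  simp only at h8 hYC
  rw [← h7] at h8
  have := dist_triangle_left (Y C) (Y B) (Y C')
  linarith

/-- The derivative of `F` along the triangular field `W`. -/
def lieDeriv {N : ℕ} (F : (Fin N → ℝ) → ℝ) (W : TriangularField N) (c : Fin N → ℝ) : ℝ :=
  ∑ j, W j (initialParams j c) * partialDeriv F j c

theorem contDiff_partialDeriv {N : ℕ} {F : (Fin N → ℝ) → ℝ} (hF : ContDiff ℝ 2 F) (j : Fin N) :
    ContDiff ℝ 1 (partialDeriv F j) :=
  (hF.fderiv_right (m := 1) (by norm_num)).clm_apply contDiff_const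

theorem contDiff_lieDeriv {N : ℕ} {F : (Fin N → ℝ) → ℝ} (hF : ContDiff ℝ 2 F)
    {W : TriangularField N} (hW : ∀ j, ContDiff ℝ 1 (W j)) : ContDiff ℝ 1 (lieDeriv F W) :=
  ContDiff.sum fun j _ => ((hW j).comp (contDiff_initialParams j)).mul (contDiff_partialDeriv hF j)

/-- If a map which commutes with translations of the last variable maps level sets of `F` to level
sets of `F`, then it maps different level sets to different ones. -/
theorem eq_of_eq_of_commute_translation {n : ℕ} {F : (Fin (n + 1) → ℝ) → ℝ} (hF : ContDiff ℝ 1 F)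
    (hne : ∀ c, partialDeriv F (Fin.last n) c ≠ 0) (hsurj : Function.Surjective F)
    {T : (Fin (n + 1) → ℝ) → Fin (n + 1) → ℝ}
    (hT : ∀ c t, T (c + Pi.single (Fin.last n) t) = T c + Pi.single (Fin.last n) t)
    (hlev : ∀ c b, F c = F b → F (T c) = F (T b)) {c b : Fin (n + 1) → ℝ}
    (h : F (T c) = F (T b)) : F c = F b := by
  have hFd : Differentiable ℝ F := hF.differentiable (by norm_num)
  obtain ⟨k, hk, hkF⟩ := exists_contDiff_factor (Y := fun c => F (T c)) hF hne hsurj (fun c => by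
    simp only [hT]
    exact hF.comp (contDiff_const.add (contDiff_single (fun _ => ℝ) 1 (Fin.last n)))) hlev
  -- Differentiating F ∘ T = k ∘ F in the last direction gives k'(F(c)) ∂_n F(c) = ∂_n F(T c), and
  -- neither partial derivative vanishes.
  have hkd : ∀ z, deriv k z ≠ 0 := fun z => by
    obtain ⟨c, rfl⟩ := hsurj z
    have h1 := (hk.differentiable (by norm_num)
      (F (c + Pi.single (Fin.last n) 0))).hasDerivAt.comp 0
      (hasDerivAt_comp_add_single_last hFd c 0)
    have h2 : (k ∘ fun t => F (c + Pi.single (Fin.last n) t)) =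
        fun t => F (T c + Pi.single (Fin.last n) t) := by
      funext t
      rw [← hT]
      exact (hkF _).symm
    rw [h2] at h1
    have h3 := h1.unique (hasDerivAt_comp_add_single_last hFd _ 0)
    simp only [Pi.single_zero, add_zero] at h3
    intro h4
    rw [h4, zero_mul] at h3
    exact hne _ h3.symm
  simp only [hkF] at h
  exact injective_of_hasDerivAt_ne_zero
    (fun z => (hk.differentiable (by norm_num) z).hasDerivAt) hkd h

open Filter Topology in
theorem tendsto_quotient_comp {N : ℕ} {F : (Fin N → ℝ) → ℝ} (hF : Differentiable ℝ F)
    {u : ℕ → Fin N → ℝ} {y v : Fin N → ℝ}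
    (hu : ∀ j, Tendsto (fun k : ℕ => ((k : ℝ) + 1) * (u k j - y j)) atTop (𝓝 (v j))) :
    Tendsto (fun k : ℕ => ((k : ℝ) + 1) * (F (u k) - F y)) atTop
      (𝓝 (∑ j, v j * partialDeriv F j y)) := by
  have h1 : Tendsto (fun k : ℕ => ((k : ℝ) + 1) • (u k - y)) atTop (𝓝 v) := tendsto_pi_nhds.mpr hu
  have h2 : Tendsto (fun k => u k - y) atTop (𝓝 0) := by
    have h3 := (tendsto_one_div_add_atTop_nhds_zero_nat (𝕜 := ℝ)).smul h1
    rw [zero_smul] at h3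
    refine h3.congr fun k => ?_
    rw [smul_smul, one_div_mul_cancel (by positivity), one_smul]
  have h4 := (hF y).hasFDerivAt.hasFDerivWithinAt (s := univ) |>.lim
    h2 (Eventually.of_forall fun _ => mem_univ _) h1
  rw [fderiv_apply_eq_sum] at h4
  simpa only [add_sub_cancel, smul_eq_mul] using h4

open Filter Topology in
/-- If the quadratures `S(x, ·)` map level sets of `F` to level sets of `F`, then for almost every
`x` the integrands form a projectable field. -/
theorem ae_isProjectable {n : ℕ} {I : Set ℝ} (hI : I.OrdConnected) {x₀ : ℝ}
    (hx₀ : x₀ ∈ I) {φ : (j : Fin (n + 1)) → ℝ → (Fin j → ℝ) → ℝ} (hφ : IsQuadratureSystem I x₀ φ)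
    {F : (Fin (n + 1) → ℝ) → ℝ} (hF : ContDiff ℝ 2 F)
    (hne : ∀ c, partialDeriv F (Fin.last n) c ≠ 0) (hsurj : Function.Surjective F)
    (hlev : ∀ x ∈ I, ∀ c b, F c = F b →
      F (shiftedQuadratures x₀ φ x c) = F (shiftedQuadratures x₀ φ x b)) :
    ∀ᵐ x ∂volume.restrict I, IsProjectable F fun j => φ j x := by
  have hFd : Differentiable ℝ F := hF.differentiable (by norm_num)
  have hF1 : ContDiff ℝ 1 F := hF.of_le (by norm_num)
  filter_upwards [ae_dense_tendsto_quotient hI hx₀ hφ, ae_restrict_mem_interior hI] with x hx hxi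
  have hxI : x ∈ I := interior_subset hxi
  have hW : ∀ j, ContDiff ℝ 1 (φ j x) := fun j => hφ.contDiff j x hxI
  have hmem : ∀ᶠ k : ℕ in atTop, x + 1 / ((k : ℝ) + 1) ∈ I := by
    have h3 : Tendsto (fun k : ℕ => x + 1 / ((k : ℝ) + 1)) atTop (𝓝 x) := by
      simpa using (tendsto_one_div_add_atTop_nhds_zero_nat (𝕜 := ℝ)).const_add x
    exact h3.eventually (mem_interior_iff_mem_nhds.mp hxi)
  have hY : ContDiff ℝ 1 (lieDeriv F fun j => φ j x) := contDiff_lieDeriv hF hW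
  have hYF : ∀ C B, F C = F B → lieDeriv F (fun j => φ j x) C = lieDeriv F (fun j => φ j x) B := by
    intro C B hCB
    refine eq_of_eq_of_dense hFd hne hY.continuous hx ?_ hCB
    rintro _ ⟨c, hc, rfl⟩ _ ⟨b, hb, rfl⟩ t hcb
    have hb' : ∀ j, Tendsto (fun k : ℕ => ((k : ℝ) + 1) *
        (shiftedQuadratures x₀ φ (x + 1 / ((k : ℝ) + 1)) (b + Pi.single (Fin.last n) t) j -
          shiftedQuadratures x₀ φ x (b + Pi.single (Fin.last n) t) j)) atTop
        (𝓝 (φ j x (initialParams j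
          (shiftedQuadratures x₀ φ x (b + Pi.single (Fin.last n) t))))) := fun j => by
      have := hb j
      rw [shiftedQuadratures_add_single_last x₀ φ x, initialParams_add_single_last]
      refine this.congr fun k => ?_
      rw [shiftedQuadratures_add_single_last, Pi.add_apply, Pi.add_apply, add_sub_add_right_eq_sub]
    rw [← shiftedQuadratures_add_single_last] at hcb ⊢
    -- Equal levels at `x` force equal levels at `x₀`, hence at every point of `I`. The difference
    -- quotients of F ∘ S at `x` therefore coincide, and so do their limits.
    have hcb' : F c = F (b + Pi.single (Fin.last n) t) :=
      eq_of_eq_of_commute_translation hF1 hne hsurj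
        (shiftedQuadratures_add_single_last x₀ φ x) (hlev x hxI) hcb
    refine tendsto_nhds_unique ((tendsto_quotient_comp hFd hc).congr' ?_)
      (tendsto_quotient_comp hFd hb')
    filter_upwards [hmem] with k hk
    rw [hcb, hlev _ hk _ _ hcb']
  exact ⟨hW, exists_contDiff_factor hF1 hne hsurj (fun c => hY.comp
    (contDiff_const.add (contDiff_single (fun _ => ℝ) 1 (Fin.last n)))) hYF⟩

/-! ### Frames of projectable fields and the linear coefficients -/

/-- The projectable fields form a vector space. -/
def projectableFields {N : ℕ} (F : (Fin N → ℝ) → ℝ) : Submodule ℝ (TriangularField N) where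
  carrier := {W | IsProjectable F W}
  add_mem' := by
    rintro W W' ⟨hW, k, hk, hkF⟩ ⟨hW', k', hk', hkF'⟩
    refine ⟨fun j => (hW j).add (hW' j), _, hk.add hk', fun c => ?_⟩
    change _ = k (F c) + k' (F c)
    rw [← hkF, ← hkF', ← Finset.sum_add_distrib]
    exact Finset.sum_congr rfl fun j _ => add_mul _ _ _
  zero_mem' := ⟨fun j => contDiff_const, fun _ => 0, contDiff_const, fun c => by simp⟩
  smul_mem' := by
    rintro r W ⟨hW, k, hk, hkF⟩
    refine ⟨fun j => (hW j).const_smul r, fun z => r * k z, contDiff_const.mul hk,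
      fun c => ?_⟩
    change _ = r * k (F c)
    rw [← hkF, Finset.mul_sum]
    exact Finset.sum_congr rfl fun j _ => mul_assoc _ _ _

/-- Independence of the integrands at `c₀` yields projectable fields which form the standard frame
at `c₀`. -/
theorem exists_projectable_frame {N : ℕ} {I : Set ℝ} {φ : (j : Fin N) → ℝ → (Fin j → ℝ) → ℝ}
    {F : (Fin N → ℝ) → ℝ} (hproj : ∀ᵐ x ∂volume.restrict I, IsProjectable F fun j => φ j x)
    {c₀ : Fin N → ℝ} (hc₀ : ∀ a : Fin N → ℝ,
      (∀ᵐ t ∂volume.restrict I, ∑ j, a j * φ j t (initialParams j c₀) = 0) → a = 0) :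
    ∃ W : Fin N → TriangularField N, (∀ i, IsProjectable F (W i)) ∧
      ∀ i j, W i j (initialParams j c₀) = if i = j then 1 else 0 := by
  let ev : TriangularField N →ₗ[ℝ] (Fin N → ℝ) :=
    { toFun := fun W j => W j (initialParams j c₀)
      map_add' := fun _ _ => rfl
      map_smul' := fun _ _ => rfl }
  have htop : (projectableFields F).map ev = ⊤ := by
    by_contra hne
    -- A nonzero functional vanishing on all values at `c₀` would be an a.e. linear relation between
    -- the integrands.
    obtain ⟨f, hf0, hf⟩ := Submodule.exists_le_ker_of_lt_top _ (lt_top_iff_ne_top.mpr hne)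
    have hfs : ∀ v, f v = ∑ j, f (Pi.single j 1) * v j := fun v => by
      conv_lhs => rw [pi_eq_sum_univ' v]
      simp [map_sum, mul_comm]
    have h0 := hc₀ (fun j => f (Pi.single j 1)) <| by
      filter_upwards [hproj] with x hx
      rw [← hfs fun j => φ j x (initialParams j c₀)]
      exact hf (Submodule.mem_map_of_mem (f := ev) (show _ ∈ projectableFields F from hx))
    refine hf0 (LinearMap.ext fun v => ?_)
    rw [hfs]
    exact Finset.sum_eq_zero fun j _ => by rw [congrFun h0 j, Pi.zero_apply, zero_mul]
  have h : ∀ i, ∃ W ∈ projectableFields F, ev W = Pi.single i 1 := fun i =>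
    Submodule.mem_map.mp (htop ▸ Submodule.mem_top)
  choose W hW hev using h
  refine ⟨W, hW, fun i j => ?_⟩
  have := congrFun (hev i) j
  rw [Pi.single_apply] at this
  simp only [eq_comm (a := i)]
  exact this

/-- The vector field of the line to which the integrands project is affine in the coordinate given
by the last variable of `F`, the others being zero. -/
theorem exists_linear_coefficients {n : ℕ} {I : Set ℝ} (hI : I.OrdConnected) {x₀ : ℝ}
    (hx₀ : x₀ ∈ I) {φ : (j : Fin (n + 1)) → ℝ → (Fin j → ℝ) → ℝ} (hφ : IsQuadratureSystem I x₀ φ)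
    (hind : IsIndependentSystem I φ) {F : (Fin (n + 1) → ℝ) → ℝ} (hF : ContDiff ℝ 2 F)
    (hne : ∀ c, partialDeriv F (Fin.last n) c ≠ 0) (hsurj : Function.Surjective F)
    (hlev : ∀ x ∈ I, ∀ c b, F c = F b →
      F (shiftedQuadratures x₀ φ x c) = F (shiftedQuadratures x₀ φ x b)) :
    (Function.Surjective fun t => F (Pi.single (Fin.last n) t)) ∧
    ∃ p q : ℝ → ℝ, LocallyIntegrableOn p I ∧ LocallyIntegrableOn q I ∧
      ∀ᵐ x ∂volume.restrict I, ∀ c t, F c = F (Pi.single (Fin.last n) t) →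
        lieDeriv F (fun j => φ j x) c =
          (q x - p x * t) * partialDeriv F (Fin.last n) (Pi.single (Fin.last n) t) := by
  have hFd : Differentiable ℝ F := hF.differentiable (by norm_num)
  have hproj := ae_isProjectable hI hx₀ hφ hF hne hsurj hlev
  obtain ⟨c₀, hc₀⟩ := hind
  obtain ⟨W, hW, hδ⟩ := exists_projectable_frame hproj hc₀
  have hrep := exists_affine_reparametrization hF hne W hW c₀ hδ
  obtain ⟨a, b, ha, hab⟩ := hrep 0
  simp only [zero_add] at hab
  choose α β hαβ using exists_affine_ratio hF hne W hW c₀ hδ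
  have hint : ∀ r : Fin (n + 1) → ℝ,
      LocallyIntegrableOn (fun x => ∑ j, r j * φ j x (initialParams j c₀)) I := fun r => by
    have h : ∀ s : Finset (Fin (n + 1)),
        LocallyIntegrableOn (fun x => ∑ j ∈ s, r j * φ j x (initialParams j c₀)) I := fun s => by
      induction s using Finset.induction_on with
      | empty => simpa using (locallyIntegrable_zero (μ := volume)).locallyIntegrableOn I
      | insert j s hj ih =>
        simp only [Finset.sum_insert hj]
        exact ((hφ.locallyIntegrable j (initialParams j c₀)).smul (r j)).add ih
    exact h Finset.univ
  -- On the line through `c₀`, with coordinate v, the field is ∑ φ_j (α_j + β_j v) ∂_v, the φ_j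
  -- being taken at `c₀`. The substitution v = a t + b passes to the last axis and yields these
  -- coefficients.
  refine ⟨fun z => ?_, _, _, hint fun j => -β j, hint fun j => (α j + β j * b) / a, ?_⟩
  · obtain ⟨c, rfl⟩ := hsurj z
    obtain ⟨a', b', ha', hab'⟩ := hrep c
    refine ⟨(b' - b) / a, ?_⟩
    have h0 := hab' 0
    simp only [Pi.single_zero, add_zero, mul_zero, zero_add] at h0
    simp only
    rw [hab, h0, mul_div_cancel₀ _ ha, sub_add_cancel]
  · filter_upwards [hproj] with x hx c t hct
    obtain ⟨-, k, hk, hkF⟩ := hx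
    have h1 : lieDeriv F (fun j => φ j x) c =
        lieDeriv F (fun j => φ j x) (c₀ + Pi.single (Fin.last n) (a * t + b)) := by
      rw [lieDeriv, lieDeriv, hkF, hkF, hct, hab]
    have h2 : partialDeriv F (Fin.last n) (Pi.single (Fin.last n) t) =
        partialDeriv F (Fin.last n) (c₀ + Pi.single (Fin.last n) (a * t + b)) * a := by
      have h3 := hasDerivAt_comp_add_single_last hFd 0 t
      simp only [zero_add, hab] at h3
      have h4 : HasDerivAt (fun t => a * t + b) a t := by
        simpa using ((hasDerivAt_id t).const_mul a).add_const b
      exact h3.unique ((hasDerivAt_comp_add_single_last hFd c₀ _).comp t h4)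
    rw [h1, h2, lieDeriv, Finset.sum_mul, ← Finset.sum_sub_distrib, Finset.sum_mul]
    refine Finset.sum_congr rfl fun j _ => ?_
    rw [initialParams_add_single_last, hαβ]
    field_simp
    ring

/-! ### Absolute continuity and the linear equation -/

namespace AbsolutelyContinuousOnInterval

open Filter Topology

variable {X Z : Type*} [PseudoMetricSpace X] [PseudoMetricSpace Z]

theorem of_dist_le {z : ℝ → Z} {a b : ℝ} (hz : AbsolutelyContinuousOnInterval z a b) {f : ℝ → X}
    {K : ℝ} (h : ∀ x ∈ uIcc a b, ∀ x' ∈ uIcc a b, dist (f x) (f x') ≤ K * dist (z x) (z x')) :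
    AbsolutelyContinuousOnInterval f a b := by
  have h1 := Tendsto.const_mul K hz
  rw [mul_zero] at h1
  refine squeeze_zero' (Eventually.of_forall fun E => Finset.sum_nonneg fun i _ => dist_nonneg) ?_ h1
  filter_upwards [mem_inf_of_right (mem_principal_self _)] with E hE
  rw [Finset.mul_sum]
  exact Finset.sum_le_sum fun i hi => h _ (hE.1 i hi).1 _ (hE.1 i hi).2

theorem pi {ι : Type*} [Fintype ι] {z : ι → ℝ → Z} {a b : ℝ}
    (hz : ∀ j, AbsolutelyContinuousOnInterval (z j) a b) :
    AbsolutelyContinuousOnInterval (fun x j => z j x) a b := by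
  have h1 := tendsto_finsetSum (Finset.univ : Finset ι) fun j _ => hz j
  rw [Finset.sum_const_zero] at h1
  refine squeeze_zero (fun E => Finset.sum_nonneg fun i _ => dist_nonneg) (fun E => ?_) h1
  rw [Finset.sum_comm]
  refine Finset.sum_le_sum fun i _ => ?_
  rw [dist_pi_le_iff (Finset.sum_nonneg fun _ _ => dist_nonneg)]
  exact fun j => Finset.single_le_sum (f := fun j => dist (z j _) (z j _))
    (fun _ _ => dist_nonneg) (Finset.mem_univ j)

theorem prodMk {f : ℝ → X} {g : ℝ → Z} {a b : ℝ} (hf : AbsolutelyContinuousOnInterval f a b)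
    (hg : AbsolutelyContinuousOnInterval g a b) :
    AbsolutelyContinuousOnInterval (fun x => (f x, g x)) a b := by
  have h1 := Tendsto.add hf hg
  rw [add_zero] at h1
  refine squeeze_zero (fun E => Finset.sum_nonneg fun i _ => dist_nonneg) (fun E => ?_) h1
  rw [← Finset.sum_add_distrib]
  refine Finset.sum_le_sum fun i _ => ?_
  rw [Prod.dist_eq]
  exact max_le_add_of_nonneg dist_nonneg dist_nonneg

theorem contDiff_comp {E : Type*} [NormedAddCommGroup E] [NormedSpace ℝ E] [ProperSpace E]
    {f : E → ℝ} (hf : ContDiff ℝ 1 f) {z : ℝ → E} {a b : ℝ}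
    (hz : AbsolutelyContinuousOnInterval z a b) :
    AbsolutelyContinuousOnInterval (fun x => f (z x)) a b := by
  obtain ⟨R, hR⟩ := hz.exists_bound
  obtain ⟨K, hK⟩ := (hf.contDiffOn (s := Metric.closedBall 0 R)).exists_lipschitzOnWith
    (by decide) (convex_closedBall _ _) (isCompact_closedBall _ _)
  exact hz.of_dist_le fun x hx x' hx' => hK.dist_le_mul _ (mem_closedBall_zero_iff.mpr (hR x hx)) _
    (mem_closedBall_zero_iff.mpr (hR x' hx'))

end AbsolutelyContinuousOnInterval

theorem LocallyAC.congr {I : Set ℝ} (hI : I.OrdConnected) {y z : ℝ → ℝ} (hy : LocallyAC I y)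
    (h : EqOn y z I) : LocallyAC I z := fun a ha b hb =>
  (hy a ha b hb).of_dist_le (K := 1) fun x hx x' hx' => by
    rw [one_mul, h (hI.uIcc_subset ha hb hx), h (hI.uIcc_subset ha hb hx')]

theorem LocallyAC.ae_differentiableAt {I : Set ℝ} (hI : I.OrdConnected) {y : ℝ → ℝ}
    (hy : LocallyAC I y) : ∀ᵐ x ∂volume.restrict I, DifferentiableAt ℝ y x := by
  refine ae_restrict_of_ae_restrict_inter_Ioo fun a b ha hb hab => ?_
  rw [ae_restrict_iff' (hI.measurableSet.inter measurableSet_Ioo)]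
  filter_upwards [(hy a ha b hb).ae_differentiableAt] with x hx hxm
  exact hx (Icc_subset_uIcc (Ioo_subset_Icc_self hxm.2))

/-- At an endpoint belonging to `I`, `deriv` depends on values outside `I`; endpoints form a null
set, so the interior decides. -/
theorem IsSolutionOn.congr {I : Set ℝ} (hI : I.OrdConnected) {E : FirstOrderODE} {y z : ℝ → ℝ}
    (hy : IsSolutionOn I E y) (h : EqOn y z I) : IsSolutionOn I E z := by
  refine ⟨hy.1.congr hI h, ?_⟩
  filter_upwards [hy.2, ae_restrict_mem_interior hI] with x hx hxi
  have h1 : y =ᶠ[nhds x] z := by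
    filter_upwards [mem_interior_iff_mem_nhds.mp hxi] with t ht using h ht
  rwa [← h (interior_subset hxi), ← h1.deriv_eq]

/-- Uniqueness for the linear equation. -/
theorem eqOn_of_linearODE {I : Set ℝ} (hI : I.OrdConnected) {x₀ : ℝ} (hx₀ : x₀ ∈ I) {p q : ℝ → ℝ}
    (hp : LocallyIntegrableOn p I) {u v : ℝ → ℝ} (hu : IsSolutionOn I (linearODE p q) u)
    (hv : IsSolutionOn I (linearODE p q) v) (h : u x₀ = v x₀) : EqOn u v I := by
  intro x hx
  have hP := (intervalIntegrable_of_locallyIntegrableOn hI hp hx₀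
    hx).absolutelyContinuousOnInterval_intervalIntegral (c := x₀) left_mem_uIcc
  have hexp := hP.contDiff_comp Real.contDiff_exp
  -- With the integrating factor exp(∫ p), the difference of two solutions is absolutely continuous
  -- with derivative 0 a.e., hence constant.
  have hac := ((hu.1 x₀ hx₀ x hx).sub (hv.1 x₀ hx₀ x hx)).mul hexp
  obtain ⟨C, hC⟩ := hac.const_of_ae_hasDerivAt_zero <| by
    have h1 : ∀ᵐ t ∂volume.restrict I, HasDerivAt
        ((u - v) * fun x => Real.exp (∫ t in x₀..x, p t)) 0 t := by
      filter_upwards [hu.2, hv.2, hu.1.ae_differentiableAt hI, hv.1.ae_differentiableAt hI,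
        ae_hasDerivAt_integral_of_locallyIntegrableOn hI hp hx₀] with t h1 h2 h3 h4 h5
      refine ((h3.hasDerivAt.sub h4.hasDerivAt).mul h5.exp).congr_deriv ?_
      simp only [linearODE] at h1 h2
      rw [Pi.sub_apply]
      linear_combination Real.exp (∫ t in x₀..t, p t) * (h1 - h2)
    filter_upwards [(ae_restrict_iff' hI.measurableSet).mp h1] with t ht htx
    exact ht (hI.uIcc_subset hx₀ hx htx)
  have h1 := hC x right_mem_uIcc
  rw [← hC x₀ left_mem_uIcc] at h1
  simp only [Pi.mul_apply, Pi.sub_apply, h, sub_self, zero_mul] at h1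
  exact sub_eq_zero.mp ((mul_eq_zero.mp h1).resolve_right (Real.exp_ne_zero _))

theorem locallyAC_shiftedQuadratures {N : ℕ} {I : Set ℝ} (hI : I.OrdConnected) {x₀ : ℝ}
    (hx₀ : x₀ ∈ I) {φ : (j : Fin N) → ℝ → (Fin j → ℝ) → ℝ} (hφ : IsQuadratureSystem I x₀ φ)
    (c : Fin N → ℝ) {a b : ℝ} (ha : a ∈ I) (hb : b ∈ I) :
    AbsolutelyContinuousOnInterval (fun x => shiftedQuadratures x₀ φ x c) a b := by
  refine AbsolutelyContinuousOnInterval.pi (z := fun j x => shiftedQuadratures x₀ φ x c j)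
    fun j => ?_
  have ha' : min a x₀ ∈ I := by rcases min_choice a x₀ with h | h <;> rwa [h]
  have hb' : max a x₀ ∈ I := by rcases max_choice a x₀ with h | h <;> rwa [h]
  have ha'' : min (min a x₀) b ∈ I := by rcases min_choice (min a x₀) b with h | h <;> rwa [h]
  have hb'' : max (max a x₀) b ∈ I := by rcases max_choice (max a x₀) b with h | h <;> rwa [h]
  have hle : min (min a x₀) b ≤ max (max a x₀) b := (min_le_right _ _).trans (le_max_right _ _)
  have h := (intervalIntegrable_of_locallyIntegrableOn hI (hφ.integrable j c) ha''
    hb'').absolutelyContinuousOnInterval_intervalIntegral (c := x₀) (by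
      rw [uIcc_of_le hle]
      exact ⟨(min_le_left _ _).trans (min_le_right _ _),
        (le_max_right _ _).trans (le_max_left _ _)⟩)
  refine (h.mono (c := a) (d := b) ?_).of_dist_le (K := 1) fun x _ x' _ => ?_
  · rw [uIcc_of_le hle]
    exact uIcc_subset_Icc ⟨(min_le_left _ _).trans (min_le_left _ _),
      (le_max_left _ _).trans (le_max_left _ _)⟩ ⟨min_le_right _ _, le_max_right _ _⟩
  · simp only [shiftedQuadratures, quadrature_eq, dist_add_right, one_mul, le_refl]

/-! ### Regularity of the partial inverse -/

theorem hasDerivAt_partial_chain {Φ : ℝ → ℝ → ℝ} {y : ℝ → ℝ} {x : ℝ}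
    (hΦ : DifferentiableAt ℝ (fun z : ℝ × ℝ => Φ z.1 z.2) (x, y x)) (hy : DifferentiableAt ℝ y x) :
    HasDerivAt (fun t => Φ t (y t))
      (deriv (fun t => Φ t (y x)) x + deriv (Φ x) (y x) * deriv y x) x := by
  have h1 := hΦ.hasFDerivAt.comp_hasDerivAt (f := fun t => (t, y t)) x
    ((hasDerivAt_id x).prodMk hy.hasDerivAt)
  have h2 := (hΦ.hasFDerivAt.comp_hasDerivAt (f := fun t => (t, y x)) x
    ((hasDerivAt_id x).prodMk (hasDerivAt_const x (y x)))).deriv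
  have h3 := (hΦ.hasFDerivAt.comp_hasDerivAt (f := fun t => (x, t)) (y x)
    ((hasDerivAt_const (y x) x).prodMk (hasDerivAt_id (y x)))).deriv
  refine h1.congr_deriv ?_
  simp only [Function.comp_def] at h2 h3
  rw [h2, show deriv (Φ x) (y x) = _ from h3, show ((1 : ℝ), deriv y x) =
    (1, 0) + deriv y x • ((0 : ℝ), (1 : ℝ)) by simp, map_add, map_smul, smul_eq_mul, mul_comm]

/-- The linear map `(h, k) ↦ (h, a h + A k)` of the plane. -/
def shearEquiv (a A : ℝ) (hA : A ≠ 0) : (ℝ × ℝ) ≃L[ℝ] (ℝ × ℝ) :=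
  ContinuousLinearEquiv.equivOfInverse
    ((ContinuousLinearMap.fst ℝ ℝ ℝ).prod
      (a • ContinuousLinearMap.fst ℝ ℝ ℝ + A • ContinuousLinearMap.snd ℝ ℝ ℝ))
    ((ContinuousLinearMap.fst ℝ ℝ ℝ).prod
      (A⁻¹ • (ContinuousLinearMap.snd ℝ ℝ ℝ - a • ContinuousLinearMap.fst ℝ ℝ ℝ)))
    (fun z => by ext <;> simp [hA]) (fun z => by ext <;> simp [hA])

open Filter Topology in
/-- The derivative of the partial inverse `Φ` of a function `Θ` of two variables. -/
theorem hasFDerivWithinAt_partial_inverse {Θ Φ : ℝ → ℝ → ℝ} {s t : Set (ℝ × ℝ)} {x η a A : ℝ}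
    (hA : A ≠ 0) (hΘ : HasFDerivWithinAt (fun z : ℝ × ℝ => Θ z.1 z.2)
      (a • ContinuousLinearMap.fst ℝ ℝ ℝ + A • ContinuousLinearMap.snd ℝ ℝ ℝ) t (x, Φ x η))
    (hlim : Tendsto (fun w : ℝ × ℝ => (w.1, Φ w.1 w.2)) (𝓝[s] (x, η)) (𝓝[t] (x, Φ x η)))
    (hmem : (x, η) ∈ s) (hinv : ∀ᶠ w in 𝓝[s] (x, η), Θ w.1 (Φ w.1 w.2) = w.2) :
    HasFDerivWithinAt (fun w : ℝ × ℝ => Φ w.1 w.2)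
      (A⁻¹ • (ContinuousLinearMap.snd ℝ ℝ ℝ - a • ContinuousLinearMap.fst ℝ ℝ ℝ)) s (x, η) := by
  -- The map (x, u) ↦ (x, Θ(x, u)) has an invertible derivative at the point. Continuity of its
  -- inverse there, which is `hlim`, suffices to differentiate the inverse.
  have h1 : HasFDerivWithinAt (fun z : ℝ × ℝ => (z.1, Θ z.1 z.2))
      (shearEquiv a A hA : (ℝ × ℝ) →L[ℝ] ℝ × ℝ) t (x, Φ x η) :=
    hasFDerivWithinAt_fst.prodMk hΘ
  have h2 := HasFDerivWithinAt.of_local_left_inverse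
    (g := fun w : ℝ × ℝ => (w.1, Φ w.1 w.2)) (a := (x, η)) hlim h1 hmem (by
      filter_upwards [hinv] with w hw
      simp only [hw])
  exact (ContinuousLinearMap.snd ℝ ℝ ℝ).hasFDerivAt.comp_hasFDerivWithinAt (x, η) h2

open Filter Topology in
/-- If `w.2` lies between the values of `Θ(w.1, ·)` at `v ± ε`, eventually along a filter for each
small `ε`, then the partial inverse `Φ` of `Θ` tends to `v`. -/
theorem tendsto_partial_inverse {I : Set ℝ} {Θ Φ : ℝ → ℝ → ℝ} (hc : ∀ x ∈ I, Continuous (Θ x))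
    (hinv : ∀ x ∈ I, ∀ u, Φ x (Θ x u) = u) {l : Filter (ℝ × ℝ)} (hl : ∀ᶠ w in l, w.1 ∈ I)
    {v δ : ℝ} (hδ : 0 < δ) (h : ∀ ε, 0 < ε → ε < δ → ∀ᶠ w in l,
      (Θ w.1 (v - ε) - w.2) * (Θ w.1 (v + ε) - w.2) < 0) :
    Tendsto (fun w : ℝ × ℝ => Φ w.1 w.2) l (𝓝 v) ∧ ∀ᶠ w in l, Θ w.1 (Φ w.1 w.2) = w.2 := by
  have key : ∀ ε, 0 < ε → ε < δ → ∀ᶠ w in l,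
      Φ w.1 w.2 ∈ Icc (v - ε) (v + ε) ∧ Θ w.1 (Φ w.1 w.2) = w.2 := by
    intro ε hε hεδ
    filter_upwards [hl, h ε hε hεδ] with w hw hs
    obtain ⟨t, ht, htw⟩ : ∃ t ∈ Icc (v - ε) (v + ε), Θ w.1 t - w.2 = 0 := by
      have hcont : Continuous fun t => Θ w.1 t - w.2 := (hc _ hw).sub continuous_const
      have hle : v - ε ≤ v + ε := by linarith
      rcases mul_neg_iff.mp hs with h6 | h6
      · exact intermediate_value_Icc' hle hcont.continuousOn ⟨h6.2.le, h6.1.le⟩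
      · exact intermediate_value_Icc hle hcont.continuousOn ⟨h6.1.le, h6.2.le⟩
    have h1 : Θ w.1 t = w.2 := sub_eq_zero.mp htw
    have h2 : Φ w.1 w.2 = t := by rw [← h1, hinv _ hw]
    exact ⟨h2 ▸ ht, by rw [h2, h1]⟩
  refine ⟨Metric.tendsto_nhds.mpr fun ε hε => ?_,
    (key (δ / 2) (half_pos hδ) (half_lt_self hδ)).mono fun w hw => hw.2⟩
  have hm : 0 < min ε δ / 2 := half_pos (lt_min hε hδ)
  have hm' : min ε δ / 2 < min ε δ := half_lt_self (lt_min hε hδ)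
  filter_upwards [key _ hm (hm'.trans_le (min_le_right _ _))] with w hw
  rw [Real.dist_eq, abs_lt]
  have := min_le_left ε δ
  constructor <;> linarith [hw.1.1, hw.1.2]

/-- A uniform expansion of `Θ(s, v)` about a transversal curve `v = u(s)`. -/
theorem exists_abs_sub_le_of_continuousOn_deriv {I : Set ℝ} {Θ : ℝ → ℝ → ℝ} {u : ℝ → ℝ} {x : ℝ}
    (hx : x ∈ interior I) (hd : ∀ s ∈ I, Differentiable ℝ (Θ s))
    (hcont : ContinuousOn (fun z : ℝ × ℝ => deriv (Θ z.1) z.2) (I ×ˢ univ))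
    (hu : ContinuousAt u x) {ε : ℝ} (hε : 0 < ε) :
    ∃ δ > 0, ∀ s v, |s - x| < δ → |v - u x| < δ →
      |Θ s v - Θ s (u s) - deriv (Θ x) (u x) * (v - u s)| ≤ ε * |v - u s| := by
  have hc := hcont (x, u x) ⟨interior_subset hx, mem_univ _⟩
  obtain ⟨δ₁, hδ₁, h1⟩ := Metric.continuousWithinAt_iff.mp hc ε hε
  obtain ⟨δ₂, hδ₂, h2⟩ := Metric.mem_nhds_iff.mp (mem_interior_iff_mem_nhds.mp hx)
  obtain ⟨δ₃, hδ₃, h3⟩ := Metric.continuousAt_iff.mp hu δ₁ hδ₁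
  refine ⟨min δ₁ (min δ₂ δ₃), lt_min hδ₁ (lt_min hδ₂ hδ₃), fun s v hs hv => ?_⟩
  have hs1 : |s - x| < δ₁ := hs.trans_le (min_le_left _ _)
  have hs2 : |s - x| < δ₂ := hs.trans_le ((min_le_right _ _).trans (min_le_left _ _))
  have hs3 : |s - x| < δ₃ := hs.trans_le ((min_le_right _ _).trans (min_le_right _ _))
  have hsI : s ∈ I := h2 hs2
  have hdA : ∀ t, HasDerivAt (fun t => Θ s t - deriv (Θ x) (u x) * t)
      (deriv (Θ s) t - deriv (Θ x) (u x)) t := fun t => by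
    simpa using ((hd s hsI) t).hasDerivAt.fun_sub ((hasDerivAt_id' t).const_mul (deriv (Θ x) (u x)))
  have h4 := (convex_ball (u x) δ₁).norm_image_sub_le_of_norm_deriv_le
    (f := fun t => Θ s t - deriv (Θ x) (u x) * t) (C := ε) (x := u s) (y := v)
    (fun t _ => (hdA t).differentiableAt) (fun t ht => by
      rw [(hdA t).deriv]
      refine (h1 (x := (s, t)) ⟨hsI, mem_univ _⟩ ?_).le
      rw [Prod.dist_eq]
      exact max_lt hs1 ht) (h3 hs3) (hv.trans_le (min_le_left _ _))
  rw [Real.norm_eq_abs, Real.norm_eq_abs] at h4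
  convert h4 using 2
  ring

open Filter Topology Asymptotics in
/-- A function of two variables, `C¹` in the second one, is differentiable at the points of a
transversal curve along which it is differentiable. -/
theorem hasFDerivAt_of_transversal {I : Set ℝ} {Θ : ℝ → ℝ → ℝ} {y u : ℝ → ℝ} {x : ℝ}
    (hx : x ∈ interior I) (hd : ∀ s ∈ I, Differentiable ℝ (Θ s))
    (hcont : ContinuousOn (fun z : ℝ × ℝ => deriv (Θ z.1) z.2) (I ×ˢ univ))
    (hyu : ∀ s ∈ I, y s = Θ s (u s)) (hy : DifferentiableAt ℝ y x) (hu : DifferentiableAt ℝ u x) :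
    HasFDerivAt (fun z : ℝ × ℝ => Θ z.1 z.2)
      ((deriv y x - deriv (Θ x) (u x) * deriv u x) • ContinuousLinearMap.fst ℝ ℝ ℝ +
        deriv (Θ x) (u x) • ContinuousLinearMap.snd ℝ ℝ ℝ) (x, u x) := by
  set A := deriv (Θ x) (u x) with hA
  have hfst : HasFDerivAt (fun z : ℝ × ℝ => z.1) (ContinuousLinearMap.fst ℝ ℝ ℝ) (x, u x) :=
    hasFDerivAt_fst
  have hw : HasFDerivAt (fun z : ℝ × ℝ => z.2 - u z.1)
      (ContinuousLinearMap.snd ℝ ℝ ℝ - deriv u x • ContinuousLinearMap.fst ℝ ℝ ℝ) (x, u x) :=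
    hasFDerivAt_snd.fun_sub (hu.hasDerivAt.comp_hasFDerivAt (x, u x) hfst)
  -- Expanding Θ(s, ·) about u(s) instead of u(x) replaces the unknown behaviour in s by that of
  -- y(s) = Θ(s, u(s)), which is differentiable at x.
  have hg : HasFDerivAt (fun z : ℝ × ℝ => y z.1 + A * (z.2 - u z.1))
      (deriv y x • ContinuousLinearMap.fst ℝ ℝ ℝ +
        A • (ContinuousLinearMap.snd ℝ ℝ ℝ - deriv u x • ContinuousLinearMap.fst ℝ ℝ ℝ))
      (x, u x) :=
    (hy.hasDerivAt.comp_hasFDerivAt (x, u x) hfst).add (hw.const_mul A)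
  have hR : HasFDerivAt (fun z : ℝ × ℝ => Θ z.1 z.2 - (y z.1 + A * (z.2 - u z.1)))
      (0 : ℝ × ℝ →L[ℝ] ℝ) (x, u x) := by
    rw [hasFDerivAt_iff_isLittleO]
    have h1 : (fun z : ℝ × ℝ => z.2 - u z.1) =O[𝓝 (x, u x)] fun z => z - (x, u x) := by
      simpa using hw.isBigO_sub
    refine IsLittleO.trans_isBigO (isLittleO_iff.mpr fun ε hε => ?_) h1
    obtain ⟨δ, hδ, h2⟩ := exists_abs_sub_le_of_continuousOn_deriv hx hd hcont hu.continuousAt hε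
    have h3 : ∀ᶠ z : ℝ × ℝ in 𝓝 (x, u x), z.1 ∈ I :=
      continuous_fst.continuousAt.eventually (mem_interior_iff_mem_nhds.mp hx)
    filter_upwards [Metric.ball_mem_nhds (x, u x) hδ, h3] with z hz hzI
    rw [Metric.mem_ball, Prod.dist_eq, max_lt_iff] at hz
    have h4 := h2 z.1 z.2 hz.1 hz.2
    rw [← hyu _ hzI] at h4
    simp only [← hyu _ (interior_subset hx), sub_self, mul_zero, add_zero, sub_zero,
      zero_apply, Real.norm_eq_abs]
    convert h4 using 2
    ring
  have h := hR.add hg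
  simp only [Pi.add_def, sub_add_cancel, zero_add] at h
  refine h.congr_fderiv ?_
  ext
  · simp
    ring
  · simp

-- Θ is known to be differentiable only at the point (x, u(x)), so the inverse function theorem does
-- not apply. Continuity of Φ comes instead from a sign change of Θ(s, ·) - η between u(x) - ε and
-- u(x) + ε, for (s, η) near (x, y(x)).
open Filter Topology in
theorem differentiableAt_partial_inverse_of_transversal {I : Set ℝ} {Θ Φ : ℝ → ℝ → ℝ}
    (hΘ : IsDiffeomorphicTransformation I Θ Φ) {y u : ℝ → ℝ} {x : ℝ} (hx : x ∈ interior I)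
    (hcont : ContinuousOn (fun z : ℝ × ℝ => deriv (Θ z.1) z.2) (I ×ˢ univ))
    (hyu : ∀ s ∈ I, y s = Θ s (u s)) (hy : DifferentiableAt ℝ y x) (hu : DifferentiableAt ℝ u x) :
    DifferentiableAt ℝ (fun z : ℝ × ℝ => Φ z.1 z.2) (x, y x) := by
  have hxI := interior_subset hx
  have hd : ∀ s ∈ I, Differentiable ℝ (Θ s) := fun s hs =>
    (hΘ.contDiff s hs).differentiable (by norm_num)
  have hA : deriv (Θ x) (u x) ≠ 0 := hΘ.deriv_ne_zero x hxI _
  have hf := hasFDerivAt_of_transversal hx hd hcont hyu hy hu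
  have hΦ : Φ x (y x) = u x := by rw [hyu x hxI, hΘ.leftInverse x hxI]
  set A := deriv (Θ x) (u x) with hAdef
  obtain ⟨δ, hδ, hest⟩ := exists_abs_sub_le_of_continuousOn_deriv hx hd hcont hu.continuousAt
    (half_pos (abs_pos.mpr hA))
  rw [← hAdef] at hest
  have hA2 : 0 < A ^ 2 := by positivity
  have hI' : ∀ᶠ w : ℝ × ℝ in 𝓝 (x, y x), w.1 ∈ I :=
    continuous_fst.continuousAt.eventually (mem_interior_iff_mem_nhds.mp hx)
  obtain ⟨h1, h2⟩ := tendsto_partial_inverse (Φ := Φ) (l := 𝓝 (x, y x)) (v := u x)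
    (fun s hs => (hd s hs).continuous) hΘ.leftInverse hI' hδ (by
    intro ε hε hεδ
    have e1 : ∀ᶠ w : ℝ × ℝ in 𝓝 (x, y x), |w.1 - x| < δ :=
      (show Tendsto (fun w : ℝ × ℝ => w.1) (𝓝 (x, y x)) (𝓝 x) from
        continuous_fst.tendsto _).eventually (Metric.ball_mem_nhds x hδ)
    have e2 : ∀ᶠ w : ℝ × ℝ in 𝓝 (x, y x), |u w.1 - u x| < ε / 2 :=
      (ContinuousAt.comp (f := fun w : ℝ × ℝ => w.1) (x := (x, y x)) hu.continuousAt
        continuous_fst.continuousAt).eventually (Metric.ball_mem_nhds (u x) (half_pos hε))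
    have e3 : ∀ᶠ w : ℝ × ℝ in 𝓝 (x, y x), |A * (w.2 - y w.1)| < A ^ 2 * ε / 4 := by
      have hc : ContinuousAt (fun w : ℝ × ℝ => |A * (w.2 - y w.1)|) (x, y x) :=
        (continuousAt_const.mul (continuous_snd.continuousAt.sub
          (ContinuousAt.comp (f := fun w : ℝ × ℝ => w.1) (x := (x, y x)) hy.continuousAt
            continuous_fst.continuousAt))).abs
      refine hc.eventually (gt_mem_nhds ?_)
      simp only [sub_self, mul_zero, abs_zero]
      positivity
    filter_upwards [e1, e2, e3, hI'] with w hw1 hw2 hw3 hwI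
    have hp := hest w.1 (u x + ε) hw1 (by rwa [add_sub_cancel_left, abs_of_pos hε])
    have hm := hest w.1 (u x - ε) hw1 (by
      rwa [sub_sub_cancel_left, abs_neg, abs_of_pos hε])
    rw [← hyu _ hwI] at hp hm
    rw [abs_lt] at hw2 hw3
    have dp : 0 < u x + ε - u w.1 := by linarith
    have dm : u x - ε - u w.1 < 0 := by linarith
    -- Multiplication by `A` removes the distinction between increasing and decreasing Θ(x, ·).
    -- Since |d| > ε / 2 below, the main term retains at least A² ε / 4, the bound allowed in `e3`.
    have hmul : ∀ D d : ℝ, |D - A * d| ≤ |A| / 2 * |d| → |A * D - A ^ 2 * d| ≤ A ^ 2 / 2 * |d| := by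
      intro D d h
      have h5 := mul_le_mul_of_nonneg_left h (abs_nonneg A)
      rw [← abs_mul] at h5
      have h6 : |A| * (|A| / 2 * |d|) = A ^ 2 / 2 * |d| := by
        rw [← sq_abs A]; ring
      rw [h6] at h5
      rwa [show A * D - A ^ 2 * d = A * (D - A * d) by ring]
    have hp' := abs_le.mp (hmul _ _ hp)
    have hm' := abs_le.mp (hmul _ _ hm)
    rw [abs_of_pos dp] at hp'
    rw [abs_of_neg dm] at hm'
    have g1 : A ^ 2 * (ε / 2) < A ^ 2 * (u x + ε - u w.1) :=
      mul_lt_mul_of_pos_left (by linarith) hA2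
    have g2 : A ^ 2 * (ε / 2) < A ^ 2 * -(u x - ε - u w.1) :=
      mul_lt_mul_of_pos_left (by linarith) hA2
    have k1 : 0 < A * (Θ w.1 (u x + ε) - w.2) := by nlinarith [hp'.1]
    have k2 : A * (Θ w.1 (u x - ε) - w.2) < 0 := by nlinarith [hm'.2]
    have k3 : A ^ 2 * ((Θ w.1 (u x - ε) - w.2) * (Θ w.1 (u x + ε) - w.2)) < 0 := by
      have := mul_neg_of_neg_of_pos k2 k1
      linarith [this, show A * (Θ w.1 (u x - ε) - w.2) * (A * (Θ w.1 (u x + ε) - w.2)) =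
        A ^ 2 * ((Θ w.1 (u x - ε) - w.2) * (Θ w.1 (u x + ε) - w.2)) by ring]
    exact (mul_neg_iff.mp k3).elim (fun h => h.2) fun h => absurd h.1 (not_lt.mpr hA2.le))
  rw [← hΦ] at hf h1
  have h3 := hasFDerivWithinAt_partial_inverse (s := univ) hA hf.hasFDerivWithinAt (t := univ)
    (by
      rw [nhdsWithin_univ, nhdsWithin_univ]
      exact continuous_fst.continuousAt.prodMk_nhds h1)
    (mem_univ _) (by rwa [nhdsWithin_univ])
  exact (hasFDerivWithinAt_univ.mp h3).differentiableAt

theorem uniqueDiffOn_prod_univ {I : Set ℝ} (hI : I.OrdConnected) (hne : (interior I).Nonempty) :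
    UniqueDiffOn ℝ (I ×ˢ (univ : Set ℝ)) :=
  (uniqueDiffOn_convex hI.convex hne).prod uniqueDiffOn_univ

theorem fderivWithin_snd_eq_deriv {I : Set ℝ} {Θ : ℝ → ℝ → ℝ}
    (hΘ : ContDiffOn ℝ 1 (fun z : ℝ × ℝ => Θ z.1 z.2) (I ×ˢ univ)) {z : ℝ × ℝ} (hz : z.1 ∈ I) :
    fderivWithin ℝ (fun z : ℝ × ℝ => Θ z.1 z.2) (I ×ˢ univ) z (0, 1) = deriv (Θ z.1) z.2 := by
  have h := ((hΘ.differentiableOn (by norm_num)) z ⟨hz, mem_univ _⟩).hasFDerivWithinAt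
  have h1 := h.comp_hasDerivAt (f := fun t => (z.1, t)) z.2
    ((hasDerivAt_const z.2 z.1).prodMk (hasDerivAt_id z.2))
    (Filter.Eventually.of_forall fun t => ⟨hz, mem_univ _⟩)
  exact h1.deriv.symm

theorem continuousOn_deriv_of_contDiffOn {I : Set ℝ} (hI : I.OrdConnected)
    (hne : (interior I).Nonempty) {Θ : ℝ → ℝ → ℝ}
    (hΘ : ContDiffOn ℝ 1 (fun z : ℝ × ℝ => Θ z.1 z.2) (I ×ˢ univ)) :
    ContinuousOn (fun z : ℝ × ℝ => deriv (Θ z.1) z.2) (I ×ˢ univ) :=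
  ((hΘ.continuousOn_fderivWithin (uniqueDiffOn_prod_univ hI hne) (by norm_num)).clm_apply
    continuousOn_const).congr fun _ hz => (fderivWithin_snd_eq_deriv hΘ hz.1).symm

open Filter Topology in
theorem tendsto_partial_inverse_of_continuousOn {I : Set ℝ} {Θ Φ : ℝ → ℝ → ℝ}
    (hΘ : IsDiffeomorphicTransformation I Θ Φ)
    (hc : ContinuousOn (fun z : ℝ × ℝ => Θ z.1 z.2) (I ×ˢ univ)) {w₀ : ℝ × ℝ}
    (hw₀ : w₀ ∈ imageRegion I Θ) :
    Tendsto (fun w : ℝ × ℝ => Φ w.1 w.2) (𝓝[I ×ˢ univ] w₀) (𝓝 (Φ w₀.1 w₀.2)) ∧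
      ∀ᶠ w in 𝓝[I ×ˢ univ] w₀, Θ w.1 (Φ w.1 w.2) = w.2 := by
  obtain ⟨x, η⟩ := w₀
  obtain ⟨hx, v, rfl⟩ : x ∈ I ∧ ∃ v, Θ x v = η := hw₀
  have hd : ∀ s ∈ I, Differentiable ℝ (Θ s) := fun s hs =>
    (hΘ.contDiff s hs).differentiable (by norm_num)
  simp only [hΘ.leftInverse x hx]
  refine tendsto_partial_inverse (fun s hs => (hd s hs).continuous) hΘ.leftInverse
    (by filter_upwards [self_mem_nhdsWithin] with w hw using hw.1) one_pos fun ε hε _ => ?_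
  have hpm : ∀ r, ContinuousOn (fun w : ℝ × ℝ => Θ w.1 r - w.2) (I ×ˢ univ) := fun r =>
    ContinuousOn.sub (hc.comp (f := fun w : ℝ × ℝ => (w.1, r))
      (continuous_fst.prodMk continuous_const).continuousOn fun w hw => ⟨hw.1, mem_univ _⟩)
      continuous_snd.continuousOn
  refine (((hpm (v - ε)).mul (hpm (v + ε))) (x, Θ x v) ⟨hx, mem_univ _⟩).eventually
    (gt_mem_nhds ?_)
  rcases strictMono_or_strictAnti_of_hasDerivAt_ne_zero (fun t => (hd x hx t).hasDerivAt)
    (hΘ.deriv_ne_zero x hx) with hm | hm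
  · exact mul_neg_of_neg_of_pos (sub_neg.mpr (hm (by linarith))) (sub_pos.mpr (hm (by linarith)))
  · exact mul_neg_of_pos_of_neg (sub_pos.mpr (hm (by linarith))) (sub_neg.mpr (hm (by linarith)))

open Filter Topology in
theorem imageRegion_mem_nhdsWithin {I : Set ℝ} {Θ Φ : ℝ → ℝ → ℝ}
    (hΘ : IsDiffeomorphicTransformation I Θ Φ)
    (hc : ContinuousOn (fun z : ℝ × ℝ => Θ z.1 z.2) (I ×ˢ univ)) {w₀ : ℝ × ℝ}
    (hw₀ : w₀ ∈ imageRegion I Θ) : imageRegion I Θ ∈ 𝓝[I ×ˢ univ] w₀ := by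
  filter_upwards [(tendsto_partial_inverse_of_continuousOn hΘ hc hw₀).2, self_mem_nhdsWithin]
    with w hw hwI using ⟨hwI.1, _, hw⟩

open Filter Topology in
/-- The inverse of a diffeomorphic transformation of the unknown which is `C¹` in both variables
is `C¹` in both variables. -/
theorem contDiffOn_partial_inverse {I : Set ℝ} (hI : I.OrdConnected)
    (hne : (interior I).Nonempty) {Θ Φ : ℝ → ℝ → ℝ} (hΘ : IsDiffeomorphicTransformation I Θ Φ)
    (hΘ1 : ContDiffOn ℝ 1 (fun z : ℝ × ℝ => Θ z.1 z.2) (I ×ˢ univ)) :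
    ContDiffOn ℝ 1 (fun z : ℝ × ℝ => Φ z.1 z.2) (imageRegion I Θ) := by
  let D := fderivWithin ℝ (fun z : ℝ × ℝ => Θ z.1 z.2) (I ×ˢ univ)
  let Γ : ℝ × ℝ → ℝ × ℝ := fun w => (w.1, Φ w.1 w.2)
  have hDc : ContinuousOn D (I ×ˢ univ) :=
    hΘ1.continuousOn_fderivWithin (uniqueDiffOn_prod_univ hI hne) (by norm_num)
  have hsub : imageRegion I Θ ⊆ I ×ˢ univ := fun w hw => ⟨hw.1, mem_univ _⟩
  have hΓt : ∀ w ∈ imageRegion I Θ, Tendsto Γ (𝓝[imageRegion I Θ] w) (𝓝[I ×ˢ univ] (Γ w)) := by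
    intro w hw
    refine tendsto_nhdsWithin_iff.mpr ⟨?_, ?_⟩
    · exact (continuous_fst.tendsto w |>.mono_left nhdsWithin_le_nhds).prodMk_nhds
        ((tendsto_partial_inverse_of_continuousOn hΘ hΘ1.continuousOn hw).1.mono_left
          (nhdsWithin_mono _ hsub))
    · filter_upwards [self_mem_nhdsWithin] with z hz using ⟨hz.1, mem_univ _⟩
  have hDΓ : ∀ v, ContinuousOn (fun w => D (Γ w) v) (imageRegion I Θ) := fun v w hw =>
    ((ContinuousLinearMap.apply ℝ ℝ v).continuous.tendsto (D (Γ w))).comp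
      ((hDc (Γ w) ⟨hw.1, mem_univ _⟩).tendsto.comp (hΓt w hw))
  have hA : ∀ w ∈ imageRegion I Θ, D (Γ w) (0, 1) ≠ 0 := fun w hw => by
    rw [show D (Γ w) (0, 1) = _ from fderivWithin_snd_eq_deriv hΘ1 (z := Γ w) hw.1]
    exact hΘ.deriv_ne_zero _ hw.1 _
  -- An explicit continuous derivative is exhibited within the region, which need not be open when
  -- `I` contains an endpoint.
  rw [show (1 : WithTop ℕ∞) = 0 + 1 from (zero_add 1).symm,
    contDiffOn_succ_iff_hasFDerivWithinAt (by simp)]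
  intro w₀ hw₀
  refine ⟨imageRegion I Θ, by rw [insert_eq_of_mem hw₀]; exact self_mem_nhdsWithin, by simp,
    fun w => (D (Γ w) (0, 1))⁻¹ • (ContinuousLinearMap.snd ℝ ℝ ℝ -
      D (Γ w) (1, 0) • ContinuousLinearMap.fst ℝ ℝ ℝ), fun w hw => ?_, ?_⟩
  · have h1 : HasFDerivWithinAt (fun z : ℝ × ℝ => Θ z.1 z.2)
        (D (Γ w) (1, 0) • ContinuousLinearMap.fst ℝ ℝ ℝ +
          D (Γ w) (0, 1) • ContinuousLinearMap.snd ℝ ℝ ℝ) (I ×ˢ univ) (Γ w) := by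
      refine ((hΘ1.differentiableOn (by norm_num)) (Γ w)
        ⟨hw.1, mem_univ _⟩).hasFDerivWithinAt.congr_fderiv ?_
      ext <;> simp [D]
    refine hasFDerivWithinAt_partial_inverse (hA w hw) h1 (hΓt w hw) hw ?_
    exact (tendsto_partial_inverse_of_continuousOn hΘ hΘ1.continuousOn hw).2.filter_mono
      (nhdsWithin_mono _ hsub)
  · rw [contDiffOn_zero]
    exact ((hDΓ _).inv₀ hA).smul (continuousOn_const.sub ((hDΓ _).smul continuousOn_const))

/-- The transform of a locally absolutely continuous function is locally absolutely continuous. -/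
theorem locallyAC_partial_inverse {I : Set ℝ} (hI : I.OrdConnected)
    (hne : (interior I).Nonempty) {Θ Φ : ℝ → ℝ → ℝ} (hΘ : IsDiffeomorphicTransformation I Θ Φ)
    (hΘ1 : ContDiffOn ℝ 1 (fun z : ℝ × ℝ => Θ z.1 z.2) (I ×ˢ univ)) {y : ℝ → ℝ}
    (hy : LocallyAC I y) (hyI : ∀ x ∈ I, (x, y x) ∈ imageRegion I Θ) :
    LocallyAC I fun x => Φ x (y x) := by
  intro a ha b hb
  have hab := hI.uIcc_subset ha hb
  set u : ℝ → ℝ := fun x => Φ x (y x) with hu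
  have hyu : ∀ x ∈ I, Θ x (u x) = y x := fun x hx => by
    obtain ⟨-, v, hv⟩ := hyI x hx
    simp only at hv
    simp only [hu]
    rw [← hv, hΘ.leftInverse x hx]
  have huc : ContinuousOn u (uIcc a b) :=
    (contDiffOn_partial_inverse hI hne hΘ hΘ1).continuousOn.comp
      (continuousOn_id.prodMk (hy a ha b hb).continuousOn) fun x hx => hyI x (hab hx)
  obtain ⟨R, hR⟩ := isCompact_uIcc.exists_bound_of_continuousOn huc
  have hKc : IsCompact (uIcc a b ×ˢ Icc (-R) R) := isCompact_uIcc.prod isCompact_Icc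
  have hKsub : uIcc a b ×ˢ Icc (-R) R ⊆ I ×ˢ univ := fun z hz => ⟨hab hz.1, mem_univ _⟩
  obtain ⟨L, hL⟩ := (hΘ1.mono hKsub).exists_lipschitzOnWith (by decide)
    ((convex_uIcc a b).prod (convex_Icc _ _)) hKc
  obtain ⟨M, hM⟩ := hKc.exists_bound_of_continuousOn
    (((continuousOn_deriv_of_contDiffOn hI hne hΘ1).mono hKsub).inv₀
      fun z hz => hΘ.deriv_ne_zero _ (hab hz.1) _)
  have hmem : ∀ x ∈ uIcc a b, u x ∈ Icc (-R) R := fun x hx => abs_le.mp (hR x hx)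
  -- `M` bounds 1 / ∂₂Θ on the compact set, so by the mean value theorem Θ(x, ·) contracts distances
  -- at most by the factor `M`.
  have hlow : ∀ x ∈ uIcc a b, ∀ v ∈ Icc (-R) R, ∀ v' ∈ Icc (-R) R,
      |v - v'| ≤ M * |Θ x v - Θ x v'| := by
    intro x hx
    have key : ∀ v ∈ Icc (-R) R, ∀ v' ∈ Icc (-R) R, v < v' →
        |v' - v| ≤ M * |Θ x v' - Θ x v| := by
      intro v hv v' hv' hlt
      have hd : Differentiable ℝ (Θ x) := (hΘ.contDiff x (hab hx)).differentiable (by norm_num)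
      obtain ⟨c, hc, hcd⟩ := exists_deriv_eq_slope (Θ x) hlt hd.continuous.continuousOn
        hd.differentiableOn
      have h1 : ‖(deriv (Θ x) c)⁻¹‖ ≤ M := hM (x, c) ⟨hx, hv.1.trans hc.1.le, hc.2.le.trans hv'.2⟩
      rw [hcd, norm_inv, Real.norm_eq_abs, abs_div, inv_div] at h1
      have h2 : 0 < |Θ x v' - Θ x v| := by
        rw [abs_pos]
        intro h0
        exact hΘ.deriv_ne_zero x (hab hx) c (by rw [hcd, h0, zero_div])
      rwa [div_le_iff₀ h2] at h1
    intro v hv v' hv'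
    rcases lt_trichotomy v v' with h | h | h
    · rw [abs_sub_comm v, abs_sub_comm (Θ x v)]
      exact key v hv v' hv' h
    · simp [h]
    · exact key v' hv' v hv h
  have hid : AbsolutelyContinuousOnInterval (fun x : ℝ => x) a b :=
    (LipschitzWith.id.lipschitzOnWith (s := uIcc a b)).absolutelyContinuousOnInterval
  have hM0 : 0 ≤ M := (norm_nonneg _).trans (hM (a, u a)
    ⟨left_mem_uIcc, hmem a left_mem_uIcc⟩)
  -- Compare u(x) and u(x') through Θ(x', ·). The difference of the images splits into Θ(x', u(x)) -
  -- Θ(x, u(x)), of size at most L |x - x'|, and y(x) - y(x').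
  refine (hid.prodMk (hy a ha b hb)).of_dist_le (K := M * (L + 1)) fun x hx x' hx' => ?_
  have h1 := hlow x' hx' (u x) (hmem x hx) (u x') (hmem x' hx')
  have h2 := hL.dist_le_mul (x', u x) ⟨hx', hmem x hx⟩ (x, u x) ⟨hx, hmem x hx⟩
  simp only [Prod.dist_eq, dist_self, hyu x (hab hx)] at h2
  rw [max_eq_left dist_nonneg, Real.dist_eq, dist_comm x' x] at h2
  rw [hyu x' (hab hx')] at h1
  have h3 : |Θ x' (u x) - y x'| ≤ |Θ x' (u x) - y x| + dist (y x) (y x') := by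
    rw [Real.dist_eq]
    exact abs_sub_le _ _ _
  have h4 : dist x x' ≤ dist (x, y x) (x', y x') := le_max_left _ _
  have h5 : dist (y x) (y x') ≤ dist (x, y x) (x', y x') := le_max_right _ _
  rw [Real.dist_eq (u x)]
  refine h1.trans ?_
  rw [mul_assoc]
  refine mul_le_mul_of_nonneg_left ?_ hM0
  have h6 := mul_le_mul_of_nonneg_left h4 L.coe_nonneg
  linarith

/-! ### From the family of quadratures to the linear equation -/

/-- An independent system of integrands lives on a nondegenerate interval. -/
theorem IsIndependentSystem.nonempty_interior {n : ℕ} {I : Set ℝ} (hI : I.OrdConnected)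
    {φ : (j : Fin (n + 1)) → ℝ → (Fin j → ℝ) → ℝ} (h : IsIndependentSystem I φ) :
    (interior I).Nonempty := by
  by_contra hne
  rw [not_nonempty_iff_eq_empty] at hne
  obtain ⟨c, hc⟩ := h
  have h1 := hc 1 <| by
    filter_upwards [ae_restrict_mem_interior hI] with x hx
    rw [hne] at hx
    exact absurd hx (notMem_empty x)
  exact one_ne_zero (congrFun h1 0)

/-- A level set of `F` is mapped by `shiftedQuadratures` into a level set of `F`, and `F` is onto,
if the family of functions is the general solution of an equation. -/
theorem surjective_and_level_of_equivalentFamilies {n : ℕ} {I : Set ℝ} {x₀ : ℝ} (hx₀ : x₀ ∈ I)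
    {g : ℝ → ℝ → ℝ} (hg : ∀ d, g d x₀ = d) {Θ : ℝ → ℝ → ℝ} (hΘ : ∀ x ∈ I, (Θ x).Injective)
    {F : (Fin (n + 1) → ℝ) → ℝ} {φ : (j : Fin (n + 1)) → ℝ → (Fin j → ℝ) → ℝ}
    (hfg : EquivalentFamilies I (quadratureFamily x₀ Θ F φ) g) :
    F.Surjective ∧ ∀ x ∈ I, ∀ c b, F c = F b →
      F (shiftedQuadratures x₀ φ x c) = F (shiftedQuadratures x₀ φ x b) := by
  have h0 : ∀ c, quadratureFamily x₀ Θ F φ c x₀ = Θ x₀ (F c) := fun c => by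
    rw [quadratureFamily, shiftedQuadratures_self]
  -- At `x₀` the quadratures vanish, so F(c) alone fixes the initial value, which is the parameter
  -- of the general solution.
  have key : ∀ c, EqOn (quadratureFamily x₀ Θ F φ c) (g (Θ x₀ (F c))) I := fun c => by
    obtain ⟨d, hd⟩ := hfg.1 c
    have h := hd hx₀
    rw [h0, hg] at h
    rwa [h]
  refine ⟨fun z => ?_, fun x hx c b hcb => hΘ x hx ?_⟩
  · obtain ⟨c, hc⟩ := hfg.2 (Θ x₀ z)
    have h := hc hx₀
    rw [h0, hg] at h
    exact ⟨c, hΘ x₀ hx₀ h⟩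
  · have h1 := key c hx
    have h2 := key b hx
    rw [← hcb] at h2
    exact h1.trans h2.symm

/-- If every value at `x₀` determines the solution, the solutions are the members of a family
equivalent to the general solution. -/
theorem isSolutionOn_iff_exists_eqOn {α : Type*} {I : Set ℝ} (hI : I.OrdConnected) {x₀ : ℝ}
    {E : FirstOrderODE} (hE : UniquelySolvable I x₀ E) {g : ℝ → ℝ → ℝ}
    (hg : IsGeneralSolution I x₀ E g) {f : α → ℝ → ℝ} (hfg : EquivalentFamilies I f g)
    (y : ℝ → ℝ) : IsSolutionOn I E y ↔ ∃ c, EqOn y (f c) I := by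
  constructor
  · intro hy
    obtain ⟨z, -, -, hz⟩ := hE (y x₀)
    obtain ⟨c, hc⟩ := hfg.2 (y x₀)
    exact ⟨c, (hz y hy rfl).trans ((hz _ (hg _).1 (hg _).2).symm.trans hc.symm)⟩
  · rintro ⟨c, hc⟩
    obtain ⟨d, hd⟩ := hfg.1 c
    exact (hg d).1.congr hI (hc.trans hd).symm

/-- Composition of an outer function with a diffeomorphism of the line. -/
theorem isDiffeomorphicTransformation_comp {I : Set ℝ} {Θ : ℝ → ℝ → ℝ} (hΘ : IsOuterFunction I Θ)
    {ψ : ℝ → ℝ} (hψ : ContDiff ℝ 1 ψ) (hψ0 : ∀ t, deriv ψ t ≠ 0) :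
    IsDiffeomorphicTransformation I (fun x u => Θ x (ψ u))
      (fun x => Function.invFun fun u => Θ x (ψ u)) := by
  have hder : ∀ x ∈ I, ∀ u, deriv (fun u => Θ x (ψ u)) u ≠ 0 := fun x hx u => by
    have h := ((((hΘ x hx).1.differentiable (by norm_num)) (ψ u)).hasDerivAt.comp u
      (hψ.differentiable (by norm_num) u).hasDerivAt).deriv
    rw [Function.comp_def] at h
    rw [h]
    exact mul_ne_zero ((hΘ x hx).2 _) (hψ0 u)
  have hC : ∀ x ∈ I, ContDiff ℝ 1 fun u => Θ x (ψ u) := fun x hx => (hΘ x hx).1.comp hψ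
  have hinv : ∀ x ∈ I, ∀ u, Function.invFun (fun u => Θ x (ψ u)) (Θ x (ψ u)) = u := fun x hx =>
    Function.leftInverse_invFun (injective_of_hasDerivAt_ne_zero
      (fun u => ((hC x hx).differentiable (by norm_num) u).hasDerivAt) (hder x hx))
  refine ⟨hC, hder, hinv, ?_, ?_⟩
  · rintro x hx - ⟨u, rfl⟩
    exact (contDiffAt_of_leftInverse (hC x hx) (hder x hx) (hinv x hx) u).1.contDiffWithinAt
  · rintro x hx - ⟨u, rfl⟩
    exact left_ne_zero_of_mul_eq_one
      (contDiffAt_of_leftInverse (hC x hx) (hder x hx) (hinv x hx) u).2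

/-- The members of an integral by quadratures, in the linearizing variable, solve the linear
equation. -/
theorem isSolutionOn_linearODE_of_quadratures {n : ℕ} {I : Set ℝ} (hI : I.OrdConnected) {x₀ : ℝ}
    (hx₀ : x₀ ∈ I) {φ : (j : Fin (n + 1)) → ℝ → (Fin j → ℝ) → ℝ} (hφ : IsQuadratureSystem I x₀ φ)
    {F : (Fin (n + 1) → ℝ) → ℝ} (hF : ContDiff ℝ 1 F) {p q ψ κ : ℝ → ℝ} (hκ : ContDiff ℝ 1 κ)
    (hκψ : ∀ z, ψ (κ z) = z) (hκ' : ∀ t, deriv κ (ψ t) * deriv ψ t = 1)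
    (hpq : ∀ᵐ x ∂volume.restrict I, ∀ c t, F c = ψ t →
      lieDeriv F (fun j => φ j x) c = (q x - p x * t) * deriv ψ t) (c : Fin (n + 1) → ℝ) :
    IsSolutionOn I (linearODE p q) fun x => κ (F (shiftedQuadratures x₀ φ x c)) := by
  refine ⟨fun a ha b hb =>
    (locallyAC_shiftedQuadratures hI hx₀ hφ c ha hb).contDiff_comp (hκ.comp hF), ?_⟩
  filter_upwards [hpq, ae_hasDerivAt_shiftedQuadratures hI hx₀ hφ c] with x hx hS
  set C := shiftedQuadratures x₀ φ x c with hC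
  have h1 := (hF.differentiable (by norm_num) C).hasFDerivAt.comp_hasDerivAt x hS
  have h2 := ((hκ.differentiable (by norm_num) (F C)).hasDerivAt.comp x h1).deriv
  rw [fderiv_apply_eq_sum] at h2
  have h3 := hx C (κ (F C)) (hκψ _).symm
  have h4 := hκ' (κ (F C))
  rw [hκψ] at h4
  simp only [lieDeriv] at h3
  simp only [Function.comp_def] at h2
  rw [linearODE, h2, h3]
  linear_combination (q x - p x * κ (F C)) * h4

/-- Where the inverse transformation is differentiable, the linear equation for `Φ(x, y)` can be
written with partial derivatives. -/
theorem transformedLinearODE_iff {p q : ℝ → ℝ} {Φ : ℝ → ℝ → ℝ} {y : ℝ → ℝ} {x : ℝ}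
    (hΦ : DifferentiableAt ℝ (fun z : ℝ × ℝ => Φ z.1 z.2) (x, y x)) (hy : DifferentiableAt ℝ y x) :
    transformedLinearODE p q Φ x (y x) (deriv y x) ↔
      linearODE p q x (Φ x (y x)) (deriv (fun t => Φ t (y t)) x) := by
  rw [transformedLinearODE, linearODE, (hasDerivAt_partial_chain hΦ hy).deriv, eq_sub_iff_add_eq]

open Topology in
/-- If the derivative of the transformation in the second variable is continuous, the linear
equation can be written with partial derivatives along solutions. -/
theorem ae_transformedLinearODE {I : Set ℝ} (hI : I.OrdConnected) {Θ Φ : ℝ → ℝ → ℝ}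
    (hΘ : IsDiffeomorphicTransformation I Θ Φ)
    (hcont : ContinuousOn (fun z : ℝ × ℝ => deriv (Θ z.1) z.2) (I ×ˢ univ)) {p q y : ℝ → ℝ}
    (hy : LocallyAC I y) (hyI : ∀ x ∈ I, (x, y x) ∈ imageRegion I Θ)
    (hu : IsSolutionOn I (linearODE p q) fun x => Φ x (y x)) :
    ∀ᵐ x ∂volume.restrict I, DifferentiableAt ℝ (fun z : ℝ × ℝ => Φ z.1 z.2) (x, y x) ∧
      DifferentiableAt ℝ y x ∧ transformedLinearODE p q Φ x (y x) (deriv y x) := by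
  filter_upwards [hy.ae_differentiableAt hI, hu.1.ae_differentiableAt hI, hu.2,
    ae_restrict_mem_interior hI] with x h1 h2 h3 hx
  have h4 := differentiableAt_partial_inverse_of_transversal hΘ hx hcont
    (fun s hs => by
      obtain ⟨-, v, hv⟩ := hyI s hs
      simp only at hv
      rw [← hv, hΘ.leftInverse s hs]) h1 h2
  exact ⟨h4, h1, (transformedLinearODE_iff h4 h1).mpr h3⟩

open Topology in
/-- For a transformation which is `C¹` in both variables, the equation with partial derivatives is
the linear equation for `Φ(x, y)`. -/
theorem isSolutionOn_linearODE_of_transformedLinearODE {I : Set ℝ} (hI : I.OrdConnected)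
    (hne : (interior I).Nonempty) {Θ Φ : ℝ → ℝ → ℝ} (hΘ : IsDiffeomorphicTransformation I Θ Φ)
    (hΘ1 : ContDiffOn ℝ 1 (fun z : ℝ × ℝ => Θ z.1 z.2) (I ×ˢ univ)) {p q y : ℝ → ℝ}
    (hyI : ∀ x ∈ I, (x, y x) ∈ imageRegion I Θ)
    (hy : IsSolutionOn I (transformedLinearODE p q Φ) y) :
    IsSolutionOn I (linearODE p q) fun x => Φ x (y x) := by
  refine ⟨locallyAC_partial_inverse hI hne hΘ hΘ1 hy.1 hyI, ?_⟩
  filter_upwards [hy.1.ae_differentiableAt hI, hy.2, ae_restrict_mem_interior hI] with x h1 h2 hx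
  have hxI := hyI x (interior_subset hx)
  have hnhds : I ×ˢ (univ : Set ℝ) ∈ 𝓝 (x, y x) :=
    prod_mem_nhds (mem_interior_iff_mem_nhds.mp hx) Filter.univ_mem
  have h3 := imageRegion_mem_nhdsWithin hΘ hΘ1.continuousOn hxI
  rw [nhdsWithin_eq_nhds.mpr hnhds] at h3
  have h4 := ((contDiffOn_partial_inverse hI hne hΘ hΘ1).contDiffAt h3).differentiableAt
    (by norm_num)
  exact (transformedLinearODE_iff h4 h1).mp h2

end

theorem corollary1p7 {n : ℕ} (I : Set ℝ) (hI : I.OrdConnected) (x₀ : ℝ) (hx₀ : x₀ ∈ I)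
    (E : FirstOrderODE) (hE : UniquelySolvable I x₀ E)
    (g : ℝ → ℝ → ℝ) (hg : IsGeneralSolution I x₀ E g)
    (Θ : ℝ → ℝ → ℝ) (F : (Fin (n + 1) → ℝ) → ℝ)
    (φ : (j : Fin (n + 1)) → ℝ → (Fin j → ℝ) → ℝ)
    (hf : IsIntegralByQuadratures I x₀ Θ F φ)
    (hfg : EquivalentFamilies I (quadratureFamily x₀ Θ F φ) g) :
    ∃ (p q : ℝ → ℝ) (Θ' Φ : ℝ → ℝ → ℝ),
      LocallyIntegrableOn p I ∧ LocallyIntegrableOn q I ∧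
      IsDiffeomorphicTransformation I Θ' Φ ∧
      -- the equation arises from `u' + p u = q` by the transformation `y = Θ'(x, u)`
      (∀ y : ℝ → ℝ, IsSolutionOn I E y ↔
        ∃ u : ℝ → ℝ, IsSolutionOn I (linearODE p q) u ∧ ∀ x ∈ I, y x = Θ' x (u x)) ∧
      -- the equation reads `d/dx Φ(x, y) = q - p Φ(x, y)`
      (∀ y : ℝ → ℝ, IsSolutionOn I E y ↔
        (∀ x ∈ I, (x, y x) ∈ imageRegion I Θ') ∧
          IsSolutionOn I (linearODE p q) (fun x => Φ x (y x))) ∧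
      -- if `∂₂Θ` is continuous on `I × ℝ`, then the left side can be written with partial
      -- derivatives of `Φ`
      (ContinuousOn (fun z : ℝ × ℝ => deriv (Θ z.1) z.2) (I ×ˢ univ) →
        ∀ y : ℝ → ℝ, IsSolutionOn I E y →
          ∀ᵐ x ∂volume.restrict I,
            DifferentiableAt ℝ (fun z : ℝ × ℝ => Φ z.1 z.2) (x, y x) ∧
              DifferentiableAt ℝ y x ∧ transformedLinearODE p q Φ x (y x) (deriv y x)) ∧
      -- if the integrands are locally dominated, the transformation is given by `Θ` and `F`,
      -- and it is as regular as `Θ`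
      (IsLocallyDominated I φ →
        (∀ x ∈ I, ∀ u, Θ' x u = Θ x (F (Pi.single (Fin.last n) u))) ∧
        (ContDiffOn ℝ 1 (fun z : ℝ × ℝ => Θ z.1 z.2) (I ×ˢ univ) →
          ContDiffOn ℝ 1 (fun z : ℝ × ℝ => Φ z.1 z.2) (imageRegion I Θ') ∧
          ∀ y : ℝ → ℝ, IsSolutionOn I E y ↔
            (∀ x ∈ I, (x, y x) ∈ imageRegion I Θ') ∧
              IsSolutionOn I (transformedLinearODE p q Φ) y)) := by
  have hΘinj : ∀ x ∈ I, (Θ x).Injective := fun x hx => injective_of_hasDerivAt_ne_zero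
    (fun u => ((hf.outer x hx).1.differentiable (by norm_num) u).hasDerivAt) (hf.outer x hx).2
  obtain ⟨hsurj, hlev⟩ :=
    surjective_and_level_of_equivalentFamilies hx₀ (fun d => (hg d).2) hΘinj hfg
  have hF1 : ContDiff ℝ 1 F := hf.admissible.1.of_le (by norm_num)
  have hF2 : ContDiff ℝ 2 F := hf.admissible.1.of_le (by norm_num)
  obtain ⟨hψsurj, p, q, hp, hq, hpq⟩ := exists_linear_coefficients hI hx₀ hf.system hf.independent
    hF2 hf.admissible.2 hsurj hlev
  set ψ : ℝ → ℝ := fun t => F (Pi.single (Fin.last n) t) with hψdef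
  have hψd : ∀ t, HasDerivAt ψ (partialDeriv F (Fin.last n) (Pi.single (Fin.last n) t)) t :=
    fun t => by
      simpa only [zero_add] using hasDerivAt_comp_add_single_last
        (hF1.differentiable (by norm_num)) 0 t
  have hψ : ContDiff ℝ 1 ψ :=
    hF1.comp (ContinuousLinearMap.single ℝ (fun _ : Fin (n + 1) => ℝ) (Fin.last n)).contDiff
  have hψ0 : ∀ t, deriv ψ t ≠ 0 := fun t => by
    rw [(hψd t).deriv]
    exact hf.admissible.2 _
  have hψinj : ψ.Injective := injective_of_hasDerivAt_ne_zero hψd fun t => hf.admissible.2 _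
  set κ := Function.invFun ψ with hκdef
  have hκl : ∀ t, κ (ψ t) = t := Function.leftInverse_invFun hψinj
  have hκr : ∀ z, ψ (κ z) = z := Function.rightInverse_invFun hψsurj
  have hκc := contDiffAt_of_leftInverse hψ hψ0 hκl
  have hκ : ContDiff ℝ 1 κ := contDiff_iff_contDiffAt.mpr fun z => by
    rw [← hκr z]
    exact (hκc _).1
  have hsolu := isSolutionOn_linearODE_of_quadratures (p := p) (q := q) hI hx₀ hf.system hF1 hκ hκr
    (fun t => (hκc t).2) (by simpa only [(hψd _).deriv] using hpq)
  have hsol := isSolutionOn_iff_exists_eqOn hI hE hg hfg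
  have hdiff := isDiffeomorphicTransformation_comp hf.outer hψ hψ0
  have h1 : ∀ y : ℝ → ℝ, IsSolutionOn I E y ↔
      ∃ u : ℝ → ℝ, IsSolutionOn I (linearODE p q) u ∧ ∀ x ∈ I, y x = Θ x (ψ (u x)) := by
    intro y
    rw [hsol]
    constructor
    · rintro ⟨c, hc⟩
      refine ⟨_, hsolu c, fun x hx => ?_⟩
      rw [hc hx, hκr, quadratureFamily]
    · rintro ⟨u, hu, hy⟩
      -- This parameter lies on the last axis, where F is ψ, so the member it defines has the value
      -- u(x₀) at x₀ in the linearizing variable.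
      refine ⟨Pi.single (Fin.last n) (u x₀), fun x hx => ?_⟩
      have h := eqOn_of_linearODE hI hx₀ hp hu (hsolu (Pi.single (Fin.last n) (u x₀)))
        (by rw [shiftedQuadratures_self]; exact (hκl _).symm) hx
      rw [hy x hx, h, hκr, quadratureFamily]
  have h2 : ∀ y : ℝ → ℝ, IsSolutionOn I E y ↔
      (∀ x ∈ I, (x, y x) ∈ imageRegion I fun x u => Θ x (ψ u)) ∧
        IsSolutionOn I (linearODE p q)
          fun x => (fun x => Function.invFun fun u => Θ x (ψ u)) x (y x) := by
    intro y
    rw [h1]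
    constructor
    · rintro ⟨u, hu, hy⟩
      refine ⟨fun x hx => ⟨hx, u x, (hy x hx).symm⟩, hu.congr hI fun x hx => ?_⟩
      simp only
      rw [hy x hx]
      exact (hdiff.leftInverse x hx (u x)).symm
    · rintro ⟨hy, hu⟩
      refine ⟨_, hu, fun x hx => ?_⟩
      obtain ⟨-, v, hv⟩ := hy x hx
      simp only at hv
      rw [← hv]
      exact (congrArg (fun t => Θ x (ψ t)) (hdiff.leftInverse x hx v)).symm
  refine ⟨p, q, fun x u => Θ x (ψ u), _, hp, hq, hdiff, h1, h2, fun hcont y hy => ?_,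
    fun _ => ⟨fun _ _ _ => rfl, fun hΘ1 => ?_⟩⟩
  · refine ae_transformedLinearODE hI hdiff ?_ hy.1 ((h2 y).mp hy).1 ((h2 y).mp hy).2
    have hψmap : ContinuousOn (fun z : ℝ × ℝ => (z.1, ψ z.2)) (I ×ˢ univ) :=
      (continuous_fst.prodMk (hψ.continuous.comp continuous_snd)).continuousOn
    refine ((hcont.comp hψmap fun z hz => ⟨hz.1, mem_univ _⟩).mul
      ((hψ.continuous_deriv le_rfl).comp continuous_snd).continuousOn).congr fun z hz => ?_
    exact (((hf.outer z.1 hz.1).1.differentiable (by norm_num) (ψ z.2)).hasDerivAt.comp z.2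
      (hψ.differentiable (by norm_num) z.2).hasDerivAt).deriv
  -- A nonempty interior makes I × ℝ a set of unique differentiability, so that the derivative
  -- within it is well defined and continuous.
  · have hne := hf.independent.nonempty_interior hI
    have hΘ1' : ContDiffOn ℝ 1 (fun z : ℝ × ℝ => (fun x u => Θ x (ψ u)) z.1 z.2) (I ×ˢ univ) :=
      hΘ1.comp (f := fun z : ℝ × ℝ => (z.1, ψ z.2))
        (contDiff_fst.prodMk (hψ.comp contDiff_snd)).contDiffOn fun z hz => ⟨hz.1, mem_univ _⟩
    refine ⟨contDiffOn_partial_inverse hI hne hdiff hΘ1', fun y => ⟨fun hy => ?_, fun hy => ?_⟩⟩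
    · refine ⟨((h2 y).mp hy).1, hy.1, ?_⟩
      filter_upwards [ae_transformedLinearODE hI hdiff
        (continuousOn_deriv_of_contDiffOn (Θ := fun x u => Θ x (ψ u)) hI hne hΘ1') hy.1 ((h2 y).mp hy).1 ((h2 y).mp hy).2]
        with x hx using hx.2.2
    · exact (h2 y).mpr ⟨hy.1,
        isSolutionOn_linearODE_of_transformedLinearODE hI hne hdiff hΘ1' hy.1 hy.2⟩
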